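/- A *ZX-diagram* with $m$ inputs and $n$ outputs consists of finitely many nodes connected by undirected wires: $Z$-spiders and $X$-spiders, each with a phase $\alpha\in\mathbb R/2\pi\mathbb Z$ and any finite number of legs, and Hadamard boxes with two legs. Every wire end lies on a leg of a node or is one of the inputs or outputs, and each leg, input and output carries exactly one wire end. Bare wires directly joining inputs/outputs, wires with both ends on the same node, and closed circles of wire are allowed. Diagrams are considered up to deformation: only the connectivity and the order of the inputs and of the outputs matter. Two ZX-diagrams with the same inputs and outputs are *equal* if one is transformed into the other by finitely many applications, in either direction and inside arbitrary diagrams, of the following rules (in which non-zero scalar factors are neglected; $\alpha,\beta$ are arbitrary phases, and a spider without a stated phase has phase $0$): - (f) a $Z$-spider with phase $\alpha$ and a $Z$-spider with phase $\beta$ that are connected by one or more wires fuse to a single $Z$-spider with phase $\alpha+\beta$, which has all the remaining legs of both; - (h) an $X$-spider with phase $\alpha$ equals a $Z$-spider with phase $\alpha$ with a Hadamard box on each of its legs; - (i1) a $Z$-spider with phase $0$ and two legs equals a bare wire; - (i2) two consecutive Hadamard boxes equal a bare wire; - ($\pi$) a two-legged $X$-spider with phase $\pi$ on one leg of a $Z$-spider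 with phase $\alpha$ may be replaced by a two-legged $X$-spider with phase $\pi$ on each of the other legs (0 or more), while the phase $\alpha$ becomes $-\alpha$; - (c) a one-legged $X$-spider attached to a leg of a $Z$-spider with phase $\alpha$ equals one one-legged $X$-spider on each of the other legs (0 or more), and the $Z$-spider disappears; - (b) for dangling wires $a_1,a_2,b_1,b_2$: two three-legged $Z$-spiders attached to $a_1$ and $a_2$ and two three-legged $X$-spiders attached to $b_1$ and $b_2$, each of the $Z$-spiders being connected by one wire to each of the $X$-spiders, equal a three-legged $X$-spider attached to $a_1,a_2$ that is connected by one wire to a three-legged $Z$-spider attached to $b_1,b_2$; - (definition of the Hadamard box) a Hadamard box equals the chain of two-legged spiders $Z$, $X$, $Z$, each with phase $\pi/2$. A *Hadamard edge* is a connection between spiders through a single Hadamard box. A ZX-diagram is *graph-like* if 1. all its spiders are $Z$-spiders; 2. $Z$-spiders are connected only via Hadamard edges (and every Hadamard box is part of such an edge); 3. there are no parallel Hadamard edges and no self-loops; 4. every input and every output is connected (by a plain wire) to a $Z$-spider, and every $Z$-spider is connected to at most one input or output. **Lemma.** Every ZX-diagram is equal to a graph-like ZX-diagram. -/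

import Mathlib

namespace ZX

/-- The building blocks of ZX-diagrams. Wires are given names (natural numbers), and a node
lists the names of the wires attached to its legs; no leg is singled out as an input or an
output, and the order of the legs is immaterial. A wire with both ends on the same node occurs
twice among its legs.
* `z α L`, `x α L`: the Z-spider and the X-spider with phase `α` and legs `L`;
* `had s(a, b)`: the Hadamard box with legs `a` and `b`;
* `seg s(a, b)`: a piece of bare wire, joining the wires `a` and `b`
  (so that `seg s(a, a)` is a closed circle of wire). -/
inductive Node where
  | z (α : Real.Angle) (L : Multiset ℕ)
  | x (α : Real.Angle) (L : Multiset ℕ)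
  | had (e : Sym2 ℕ)
  | seg (e : Sym2 ℕ)

/-- The names of the wires at the legs of a node, with multiplicity. -/
def Node.legs : Node → Multiset ℕ
  | z _ L => L
  | x _ L => L
  | had e => e.toMultiset
  | seg e => e.toMultiset

/-- The legs of a Z-spider; nothing for the other nodes. -/
def Node.zLegs : Node → Multiset ℕ
  | z _ L => L
  | _ => 0

/-- Renaming the wires of a node. -/
def Node.rename (f : ℕ → ℕ) : Node → Node
  | z α L => z α (L.map f)
  | x α L => x α (L.map f)
  | had e => had (e.map f)
  | seg e => seg (e.map f)

/-- A ZX-diagram with `m` inputs and `n` outputs: finitely many nodes, and for each input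
(`Sum.inl i`) and each output (`Sum.inr j`) the wire attached to it, where every wire that
occurs has exactly two ends. -/
structure Diagram (m n : ℕ) where
  nodes : Multiset Node
  boundary : Fin m ⊕ Fin n → ℕ
  two_ends : ∀ a ∈ nodes.bind Node.legs + Finset.univ.val.map boundary,
    (nodes.bind Node.legs + Finset.univ.val.map boundary).count a = 2

/-- The rules of the ZX-calculus (scalar factors being neglected), as pairs of pictures with the
same dangling wires. Wires occurring twice in a picture are internal to it. -/
inductive Rule : Multiset Node → Multiset Node → Prop
  /-- Spider fusion, along one or more wires `S`. -/
  | f (α β : Real.Angle) (A B S : Multiset ℕ) (hS : S ≠ 0) :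
      Rule {.z α (A + S), .z β (B + S)} {.z (α + β) (A + B)}
  /-- Colour change: an X-spider is a Z-spider with a Hadamard box on every leg. -/
  | h (α : Real.Angle) (l : Multiset (ℕ × ℕ)) :
      Rule {.x α (l.map Prod.fst)}
        (.z α (l.map Prod.snd) ::ₘ l.map fun p => .had s(p.1, p.2))
  /-- A phase-free Z-spider with two legs is a bare wire. -/
  | i1 (a b : ℕ) : Rule {.z 0 {a, b}} {.seg s(a, b)}
  /-- Two consecutive Hadamard boxes cancel. -/
  | i2 (a b c : ℕ) : Rule {.had s(a, c), .had s(c, b)} {.seg s(a, b)}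
  /-- An X-spider with two legs and phase `π` is pushed through a Z-spider,
  whose phase changes sign. -/
  | pi (α : Real.Angle) (a c : ℕ) (l : Multiset (ℕ × ℕ)) :
      Rule {.x (Real.pi : ℝ) {a, c}, .z α (c ::ₘ l.map Prod.fst)}
        (.z (-α) (a ::ₘ l.map Prod.snd) ::ₘ l.map fun p => .x (Real.pi : ℝ) {p.2, p.1})
  /-- A phase-free X-spider with one leg is copied by a Z-spider. -/
  | c (α : Real.Angle) (c : ℕ) (B : Multiset ℕ) :
      Rule {.x 0 {c}, .z α (c ::ₘ B)} (B.map fun b => .x 0 {b})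
  /-- Bialgebra rule. -/
  | b (a₁ a₂ b₁ b₂ p q r s c : ℕ) :
      Rule {.z 0 {a₁, p, q}, .z 0 {a₂, r, s}, .x 0 {p, r, b₁}, .x 0 {q, s, b₂}}
        {.x 0 {a₁, a₂, c}, .z 0 {c, b₁, b₂}}
  /-- The definition of the Hadamard box in terms of spiders. -/
  | hdef (a b c d : ℕ) :
      Rule {.had s(a, b)}
        {.z (Real.pi / 2 : ℝ) {a, c}, .x (Real.pi / 2 : ℝ) {c, d}, .z (Real.pi / 2 : ℝ) {d, b}}

namespace Diagram

variable {m n : ℕ}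

/-- One step of reasoning with diagrams: a deformation (the names of the wires do not matter, and
a piece of bare wire can be absorbed by the wires that it joins), or the replacement of one side
of a rule by the other inside a diagram. As both diagrams are required to be well formed, the
internal wires of the two sides of the rule do not occur elsewhere. -/
inductive Step : Diagram m n → Diagram m n → Prop
  | iso (D D' : Diagram m n) (σ : Equiv.Perm ℕ)
      (hn : D'.nodes = D.nodes.map (Node.rename σ))
      (hb : D'.boundary = σ ∘ D.boundary) : Step D D'
  | straighten (D D' : Diagram m n) (a b : ℕ) (hab : a ≠ b) (C : Multiset Node)
      (hD : D.nodes = .seg s(a, b) ::ₘ C)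
      (hn : D'.nodes = C.map (Node.rename (Function.update id b a)))
      (hb : D'.boundary = Function.update id b a ∘ D.boundary) : Step D D'
  | rule (D D' : Diagram m n) (L R C : Multiset Node) (hLR : Rule L R)
      (hD : D.nodes = L + C) (hD' : D'.nodes = R + C)
      (hb : D'.boundary = D.boundary) : Step D D'

/-- Equality of diagrams in the ZX-calculus: the equivalence relation generated by deformations
and by the rules applied inside a diagram, in either direction. -/
def Equal : Diagram m n → Diagram m n → Prop := Relation.EqvGen Step

/-- The ends of wires that lie on Z-spiders, with multiplicity. -/
def zEnds (D : Diagram m n) : Multiset ℕ := D.nodes.bind Node.zLegs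

/-- Graph-like diagrams. A Hadamard edge is a Hadamard box both of whose legs are attached to
spiders. -/
structure GraphLike (D : Diagram m n) : Prop where
  /-- All spiders are Z-spiders (and there are no superfluous bare wires: the only other nodes
  are the Hadamard boxes). -/
  only_z : ∀ v ∈ D.nodes, (∃ α L, v = .z α L) ∨ ∃ e, v = .had e
  /-- No plain wire has both ends on Z-spiders. -/
  no_plain : ∀ a, D.zEnds.count a ≤ 1
  /-- Every Hadamard box is a Hadamard edge between Z-spiders. -/
  had_edge : ∀ a b, .had s(a, b) ∈ D.nodes → a ∈ D.zEnds ∧ b ∈ D.zEnds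
  /-- There are no Hadamard self-loops. -/
  no_loop : ∀ α L a b, .z α L ∈ D.nodes → .had s(a, b) ∈ D.nodes → a ∈ L → b ∉ L
  /-- There are no parallel Hadamard edges. -/
  no_parallel : ∀ α β L M a b c d, .z α L ∈ D.nodes → .z β M ∈ D.nodes →
    .had s(a, b) ∈ D.nodes → .had s(c, d) ∈ D.nodes →
    a ∈ L → b ∈ M → c ∈ L → d ∈ M → s(a, b) = s(c, d)
  /-- Every input and every output is connected to a Z-spider. -/
  boundary_z : ∀ p, D.boundary p ∈ D.zEnds
  /-- Every Z-spider is connected to at most one input or output. -/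
  boundary_inj : ∀ α L p q, .z α L ∈ D.nodes →
    D.boundary p ∈ L → D.boundary q ∈ L → p = q

end Diagram

end ZX

namespace ZX

/-! Colour change turns X-spiders into Z-spiders and Hadamard boxes, a bare wire is a phase-free
Z-spider, and a Hadamard box unfolds by its definition and one more colour change into Z-spiders
joined by Hadamard edges (`had_gadget`). Every box is unfolded, whatever it is attached to, so no
case distinction on its neighbours arises. This gives `exists_reduced`.

Each input and output is then moved behind a wire written as two Hadamard boxes, both unfolded
(`exists_isolated`). The spider at the boundary now has two legs, one at the boundary and one at a
box. It meets no other spider along a plain wire, and a loop or a parallel pair would need two box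
legs on it. Hence the later simplifications never touch it, and the boundary conditions of
graph-likeness persist.

What remains is to fuse along plain wires, to trade a Hadamard loop for a phase `π`, and to delete
parallel pairs of Hadamard edges. Each move lowers the number of wire ends at nodes, so the process
stops, and where no move applies the diagram is graph-like. Scalars created on the way stay as
legless Z-spiders.

The last two moves rest on the Hopf law `hopf`, which is not among the rules. It comes from
evaluating three alternating CNOTs, applied to a one-legged X-spider, in two ways by bialgebra and
copying. `parallel` is the Hopf law after a colour change, and `loop` follows from it by unfolding
the box.

Since wires carry names, `Derivable` packages replacements valid in every context. Closure under
renaming and composition (`Derivable.trans`) allows identities to be checked on numerals and then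
transplanted. -/

/-! ### Wire ends and renaming -/

/-- The ends of wires at the legs of a collection of nodes, with multiplicity. -/
def ends (N : Multiset Node) : Multiset ℕ := N.bind Node.legs

@[simp] lemma ends_zero : ends 0 = 0 := rfl
@[simp] lemma ends_add (M N : Multiset Node) : ends (M + N) = ends M + ends N :=
  Multiset.add_bind ..
@[simp] lemma ends_cons (v : Node) (N : Multiset Node) : ends (v ::ₘ N) = v.legs + ends N :=
  Multiset.cons_bind ..
@[simp] lemma ends_singleton (v : Node) : ends {v} = v.legs := Multiset.singleton_bind ..
@[simp] lemma legs_z (α L) : (Node.z α L).legs = L := rfl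
@[simp] lemma legs_x (α L) : (Node.x α L).legs = L := rfl
@[simp] lemma legs_had (a b : ℕ) : (Node.had s(a, b)).legs = {a, b} := rfl
@[simp] lemma legs_seg (a b : ℕ) : (Node.seg s(a, b)).legs = {a, b} := rfl

lemma toMultiset_map (f : ℕ → ℕ) (e : Sym2 ℕ) : (e.map f).toMultiset = e.toMultiset.map f := by
  induction e with | _ a b => rfl

lemma legs_rename (f : ℕ → ℕ) (v : Node) : (v.rename f).legs = v.legs.map f := by
  cases v <;> simp [Node.rename, Node.legs, toMultiset_map]

lemma ends_rename (f : ℕ → ℕ) (N : Multiset Node) :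
    ends (N.map (Node.rename f)) = (ends N).map f := by
  simp [ends, Multiset.bind_map, Multiset.map_bind, legs_rename]

lemma rename_eq_self {f : ℕ → ℕ} {v : Node} (h : ∀ a ∈ v.legs, f a = a) : v.rename f = v := by
  have key : ∀ L : Multiset ℕ, (∀ a ∈ L, f a = a) → L.map f = L := fun L hL => by
    conv_rhs => rw [← Multiset.map_id L]
    exact Multiset.map_congr rfl hL
  cases v with
  | z α L => simp [Node.rename, key L h]
  | x α L => simp [Node.rename, key L h]
  | had e =>
    induction e with | _ a b =>
    simp at h
    simp [Node.rename, h.1, h.2]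
  | seg e =>
    induction e with | _ a b =>
    simp at h
    simp [Node.rename, h.1, h.2]

lemma mem_ends {N : Multiset Node} {a : ℕ} : a ∈ ends N ↔ ∃ v ∈ N, a ∈ v.legs := by
  simp [ends]

lemma map_rename_eq_self {f : ℕ → ℕ} {N : Multiset Node} (h : ∀ a ∈ ends N, f a = a) :
    N.map (Node.rename f) = N := by
  conv_rhs => rw [← Multiset.map_id N]
  exact Multiset.map_congr rfl fun v hv =>
    rename_eq_self fun a ha => h a (mem_ends.2 ⟨v, hv, ha⟩)

lemma map_rename_congr {f g : ℕ → ℕ} {N : Multiset Node} (h : ∀ a ∈ ends N, f a = g a) :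
    N.map (Node.rename f) = N.map (Node.rename g) := by
  refine Multiset.map_congr rfl fun v hv => ?_
  have h' : ∀ a ∈ v.legs, f a = g a := fun a ha => h a (mem_ends.2 ⟨v, hv, ha⟩)
  cases v with
  | z α L => simp only [Node.rename, Node.z.injEq, true_and]; exact Multiset.map_congr rfl h'
  | x α L => simp only [Node.rename, Node.x.injEq, true_and]; exact Multiset.map_congr rfl h'
  | had e =>
    induction e with | _ a b =>
    simp at h'
    simp [Node.rename, h'.1, h'.2]
  | seg e =>
    induction e with | _ a b =>
    simp at h'
    simp [Node.rename, h'.1, h'.2]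

lemma rename_rename (f g : ℕ → ℕ) (v : Node) : (v.rename f).rename g = v.rename (g ∘ f) := by
  cases v with
  | z α L => simp [Node.rename]
  | x α L => simp [Node.rename]
  | had e => induction e with | _ a b => rfl
  | seg e => induction e with | _ a b => rfl

lemma exists_bound (s : Multiset ℕ) : ∃ K, ∀ a ∈ s, a < K :=
  ⟨s.toFinset.sup id + 1, fun _ ha =>
    Nat.lt_succ_of_le (Finset.le_sup (f := id) (Multiset.mem_toFinset.2 ha))⟩

/-- Every finite injective assignment of names extends to a permutation. -/
lemma exists_perm (f : ℕ → ℕ) (s : Finset ℕ) (hf : Set.InjOn f s) :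
    ∃ σ : Equiv.Perm ℕ, ∀ i ∈ s, σ i = f i := by
  induction s using Finset.induction_on with
  | empty => exact ⟨1, by simp⟩
  | insert k s hk ih =>
    obtain ⟨σ, hσ⟩ := ih (hf.mono (by simp))
    refine ⟨σ.trans (Equiv.swap (σ k) (f k)), fun i hi => ?_⟩
    rcases Finset.mem_insert.1 hi with rfl | hi'
    · simp
    · have h1 : i ≠ k := by rintro rfl; exact hk hi'
      have h2 : f i ≠ f k := fun h => h1 (hf hi (by simp) h)
      have h3 : f i ≠ σ k := by rw [← hσ i hi']; exact fun h => h1 (σ.injective h)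
      simp [hσ i hi', Equiv.swap_apply_of_ne_of_ne h3 h2]

/-! ### Well-formedness by counting wire ends -/

namespace Diagram

variable {m n : ℕ}

/-- The ends of wires at the inputs and outputs. -/
def bdry (b : Fin m ⊕ Fin n → ℕ) : Multiset ℕ := Finset.univ.val.map b

lemma count_ends (D : Diagram m n) (a : ℕ) :
    (ends D.nodes).count a + (bdry D.boundary).count a = 0 ∨
    (ends D.nodes).count a + (bdry D.boundary).count a = 2 := by
  rw [← Multiset.count_add]
  by_cases h : a ∈ ends D.nodes + bdry D.boundary
  · exact .inr (D.two_ends a h)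
  · exact .inl (Multiset.count_eq_zero.2 h)

/-- Building a diagram from the numbers of ends of its wires. -/
def mk' (N : Multiset Node) (b : Fin m ⊕ Fin n → ℕ)
    (h : ∀ a, (ends N).count a + (bdry b).count a = 0 ∨ (ends N).count a + (bdry b).count a = 2) :
    Diagram m n where
  nodes := N
  boundary := b
  two_ends a ha := by
    have := h a
    rw [← Multiset.count_add] at this
    rcases this with h | h
    · exact absurd ha (Multiset.count_eq_zero.1 h)
    · exact h

/-- Renaming all wires of a diagram. -/
def rename (D : Diagram m n) (σ : Equiv.Perm ℕ) : Diagram m n :=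
  mk' (D.nodes.map (Node.rename σ)) (σ ∘ D.boundary) fun a => by
    have h := D.count_ends (σ.symm a)
    have e : bdry (σ ∘ D.boundary) = (bdry D.boundary).map σ := by simp [bdry]
    rw [ends_rename, e]
    have k : ∀ s : Multiset ℕ, (s.map σ).count a = s.count (σ.symm a) := fun s => by
      conv_lhs => rw [← σ.apply_symm_apply a]
      exact Multiset.count_map_eq_count' _ _ σ.injective _
    rwa [k, k]

lemma equal_rename (D : Diagram m n) (σ : Equiv.Perm ℕ) : D.Equal (D.rename σ) :=
  .rel _ _ (.iso _ _ σ rfl rfl)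

lemma Equal.refl (D : Diagram m n) : D.Equal D := Relation.EqvGen.refl _
lemma Equal.symm {D D' : Diagram m n} (h : D.Equal D') : D'.Equal D := Relation.EqvGen.symm _ _ h
lemma Equal.trans {D D' D'' : Diagram m n} (h : D.Equal D') (h' : D'.Equal D'') : D.Equal D'' :=
  Relation.EqvGen.trans _ _ _ h h'

end Diagram

/-! ### Replacements valid in every context -/

/-- Two pictures with wire ends `A` and `B` have the same dangling wires. -/
def Compat (A B : Multiset ℕ) : Prop :=
  ∀ a ∈ A + B, A.count a ≤ 2 ∧ B.count a ≤ 2 ∧ (A.count a = 1 ↔ B.count a = 1)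

instance (A B : Multiset ℕ) : Decidable (Compat A B) := by unfold Compat; infer_instance

/-- The bounded quantifier in `Compat` makes it decidable on concrete pictures; this unbounded form
suits `omega`. -/
lemma compat_iff {A B : Multiset ℕ} :
    Compat A B ↔ ∀ a, A.count a ≤ 2 ∧ B.count a ≤ 2 ∧ (A.count a = 1 ↔ B.count a = 1) := by
  refine ⟨fun h a => ?_, fun h a _ => h a⟩
  by_cases ha : a ∈ A + B
  · exact h a ha
  · have := Multiset.count_eq_zero.2 ha
    rw [Multiset.count_add] at this
    omega

lemma Compat.symm {A B : Multiset ℕ} (h : Compat A B) : Compat B A := by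
  rw [compat_iff] at *
  exact fun a => ⟨(h a).2.1, (h a).1, (h a).2.2.symm⟩

lemma Compat.trans {A B C : Multiset ℕ} (h : Compat A B) (h' : Compat B C) : Compat A C := by
  rw [compat_iff] at *
  exact fun a => ⟨(h a).1, (h' a).2.1, (h a).2.2.trans (h' a).2.2⟩

/-- The pictures `L` and `R` have the same dangling wires, and may be replaced by one another
inside every diagram. -/
def Derivable (L R : Multiset Node) : Prop :=
  Compat (ends L) (ends R) ∧ ∀ (m n : ℕ) (D D' : Diagram m n) (C : Multiset Node),
    D.nodes = L + C → D'.nodes = R + C → D'.boundary = D.boundary → D.Equal D'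

namespace Derivable

lemma of_rule {L R : Multiset Node} (h : Rule L R) (hc : Compat (ends L) (ends R)) :
    Derivable L R :=
  ⟨hc, fun _ _ D D' C hD hD' hb => .rel _ _ (.rule D D' L R C h hD hD' hb)⟩

lemma symm {L R : Multiset Node} (h : Derivable L R) : Derivable R L :=
  ⟨h.1.symm, fun m n D D' C hD hD' hb => (h.2 m n D' D C hD' hD hb.symm).symm⟩

lemma add {L R : Multiset Node} (h : Derivable L R) (X : Multiset Node)
    (hc : Compat (ends (L + X)) (ends (R + X))) : Derivable (L + X) (R + X) :=
  ⟨hc, fun m n D D' C hD hD' hb =>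
    h.2 m n D D' (X + C) (by rw [hD, add_assoc]) (by rw [hD', add_assoc]) hb⟩

/-- A derivable replacement inside a larger picture. -/
lemma step {L R K K' : Multiset Node} (h : Derivable K K') (X : Multiset Node) (hL : L = K + X)
    (hR : R = K' + X) (hc : Compat (ends L) (ends R)) : Derivable L R := by
  subst hL hR
  exact h.add X hc

/-- `Derivable` speaks only of two given diagrams, so the second has to be built. Names of `L` keep
a legal count by `Compat`; names new in `R` do because they are fresh. -/
lemma apply {L R C : Multiset Node} (h : Derivable L R) {m n : ℕ} (D : Diagram m n)
    (hD : D.nodes = L + C)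
    (hf : ∀ a ∈ ends R, a ∉ ends L → a ∉ ends C ∧ ∀ p, D.boundary p ≠ a) :
    ∃ D' : Diagram m n, D'.nodes = R + C ∧ D'.boundary = D.boundary ∧ D.Equal D' := by
  refine ⟨Diagram.mk' (R + C) D.boundary fun a => ?_, rfl, rfl, h.2 m n _ _ C hD rfl rfl⟩
  have h1 := D.count_ends a
  have h2 := compat_iff.1 h.1 a
  rw [hD, ends_add, Multiset.count_add] at h1
  rw [ends_add, Multiset.count_add]
  by_cases hL : a ∈ ends L
  · have := Multiset.count_pos.2 hL
    omega
  · have hL' := Multiset.count_eq_zero.2 hL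
    by_cases hR : a ∈ ends R
    · have hR' := Multiset.count_pos.2 hR
      have hC := Multiset.count_eq_zero.2 (hf a hR hL).1
      have hB : (Diagram.bdry D.boundary).count a = 0 := by
        refine Multiset.count_eq_zero.2 fun hm => ?_
        obtain ⟨p, -, hp⟩ := Multiset.mem_map.1 hm
        exact (hf a hR hL).2 p hp
      omega
    · have hR' := Multiset.count_eq_zero.2 hR
      omega

lemma rename_perm {L R : Multiset Node} (h : Derivable L R) (σ : Equiv.Perm ℕ) :
    Derivable (L.map (Node.rename σ)) (R.map (Node.rename σ)) := by
  constructor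
  · rw [compat_iff]
    intro a
    have k : ∀ s : Multiset ℕ, (s.map σ).count a = s.count (σ.symm a) := fun s => by
      conv_lhs => rw [← σ.apply_symm_apply a]
      exact Multiset.count_map_eq_count' _ _ σ.injective _
    rw [ends_rename, ends_rename, k, k]
    exact compat_iff.1 h.1 _
  · intro m n D D' C hD hD' hb
    have k : ∀ N : Multiset Node, (N.map (Node.rename σ)).map (Node.rename σ.symm) = N := by
      intro N
      rw [Multiset.map_map]
      simp only [Function.comp_def, rename_rename, Equiv.symm_apply_apply]
      exact map_rename_eq_self fun _ _ => rfl
    refine (D.equal_rename σ.symm).trans (.trans ?_ (D'.equal_rename σ.symm).symm)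
    refine h.2 m n _ _ (C.map (Node.rename σ.symm)) ?_ ?_ ?_
    · simp [Diagram.rename, Diagram.mk', hD, k]
    · simp [Diagram.rename, Diagram.mk', hD', k]
    · simp [Diagram.rename, Diagram.mk', hb]

/-- Instantiates identities proved on numerals: only finitely many names matter, and an injection on
these extends to a permutation. -/
lemma rename {L R : Multiset Node} (h : Derivable L R) (f : ℕ → ℕ)
    (hf : Set.InjOn f (ends L + ends R).toFinset) :
    Derivable (L.map (Node.rename f)) (R.map (Node.rename f)) := by
  obtain ⟨σ, hσ⟩ := exists_perm f _ hf
  have := h.rename_perm σ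
  rwa [map_rename_congr (N := L) (f := σ) (g := f) fun a ha => hσ a (by simp [ha]),
    map_rename_congr (N := R) (f := σ) (g := f) fun a ha => hσ a (by simp [ha])] at this

/-- The obstacle is that internal wires of `M` may bear names used in the context `C`, so that `M +
C` is no diagram. The context is renamed away from them, without affecting `L` and `R`. -/
lemma trans {L M R : Multiset Node} (h : Derivable L M) (h' : Derivable M R) :
    Derivable L R := by
  refine ⟨h.1.trans h'.1, fun m n D D' C hD hD' hb => ?_⟩
  obtain ⟨K, hK⟩ := exists_bound (ends D.nodes + ends D'.nodes + ends M +
    Diagram.bdry D.boundary)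
  let E := ends C + Diagram.bdry D.boundary
  -- The only possible clashes: a name dangling in `M` also dangles in `L`, so the context holds
  -- exactly its other end.
  let I : Set ℕ := {a | E.count a = 2 ∧ (ends M).count a = 2}
  have hcL : ∀ a, (ends L).count a + E.count a = 0 ∨ (ends L).count a + E.count a = 2 :=
    fun a => by simpa [hD, E, add_assoc] using D.count_ends a
  have hcR : ∀ a, (ends R).count a + E.count a = 0 ∨ (ends R).count a + E.count a = 2 :=
    fun a => by simpa [hD', hb, E, add_assoc] using D'.count_ends a
  have hIK : ∀ a ∈ I, a < K := fun a ha => hK a (by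
    have : a ∈ ends M := Multiset.count_pos.1 (by have := ha.2; omega)
    simp [this])
  classical
  -- Exchanges `I` with its translate by `K`, which lies above all names in use.
  let s : ℕ → ℕ := fun a => if a ∈ I then a + K else if K ≤ a ∧ a - K ∈ I then a - K else a
  have hs : Function.Involutive s := by
    intro a
    simp only [s]
    by_cases h1 : a ∈ I
    · have h2 : a + K ∉ I := fun h => by have := hIK _ h; omega
      simp [h1, h2]
    · by_cases h2 : K ≤ a ∧ a - K ∈ I
      · simp [h1, h2]
      · rw [if_neg h1, if_neg h2, if_neg h1, if_neg h2]
  let σ : Equiv.Perm ℕ := hs.toPerm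
  have hσs : ∀ a, σ a = s a := fun a => rfl
  have hσ : σ.symm = σ := rfl
  have hfix : ∀ a, a < K → a ∉ I → σ a = a := fun a h1 h2 => by
    simp only [hσs, s]
    rw [if_neg h2, if_neg (by omega)]
  -- Both ends of a wire in `I` lie in the context, so none is left for `L`; likewise for `R`.
  have hLfix : L.map (Node.rename σ) = L := map_rename_eq_self fun a ha => by
    refine hfix a (hK a (by simp [hD, ha])) fun hI => ?_
    have h1 := Multiset.count_pos.2 ha
    have h2 := hcL a
    have h3 := hI.1
    omega
  have hRfix : R.map (Node.rename σ) = R := map_rename_eq_self fun a ha => by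
    refine hfix a (hK a (by simp [hD', ha])) fun hI => ?_
    have h1 := Multiset.count_pos.2 ha
    have h2 := hcR a
    have h3 := hI.1
    omega
  have hwf : ∀ a, (ends (M + C.map (Node.rename σ))).count a +
        (Diagram.bdry (σ ∘ D.boundary)).count a = 0 ∨
      (ends (M + C.map (Node.rename σ))).count a +
        (Diagram.bdry (σ ∘ D.boundary)).count a = 2 := by
    intro a
    have e : Diagram.bdry (σ ∘ D.boundary) = (Diagram.bdry D.boundary).map σ := by
      simp [Diagram.bdry]
    rw [e, ends_add, ends_rename, Multiset.count_add, add_assoc, ← Multiset.count_add,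
      ← Multiset.map_add]
    have k : (E.map σ).count a = E.count (σ a) := by
      conv_lhs => rw [← σ.apply_symm_apply a]
      exact Multiset.count_map_eq_count' _ _ σ.injective _
    rw [k]
    have hEK : ∀ b, K ≤ b → E.count b = 0 := fun b hb' =>
      Multiset.count_eq_zero.2 fun hm => by
        have := hK b (by
          rw [hD, ends_add]
          simp only [E, Multiset.mem_add] at hm ⊢
          tauto)
        omega
    have hc := compat_iff.1 h.1 a
    by_cases h1 : a ∈ I
    · have : σ a = a + K := by simp [hσs, s, h1]
      rw [this, hEK _ (by omega), h1.2]
      simp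
    · by_cases h2 : K ≤ a ∧ a - K ∈ I
      · have e1 : σ a = a - K := by simp [hσs, s, h1, h2]
        have e2 : (ends M).count a = 0 := Multiset.count_eq_zero.2 fun hm => by
          have := hK a (by simp [hm])
          omega
        have := h2.2.1
        rw [e1, e2]
        omega
      · have e1 : σ a = a := by simp only [hσs, s]; rw [if_neg h1, if_neg h2]
        rw [e1]
        have h3 := hcL a
        have h4 : ¬ (E.count a = 2 ∧ (ends M).count a = 2) := h1
        omega
  refine (D.equal_rename σ).trans (.trans ?_ (D'.equal_rename σ).symm)
  refine Diagram.Equal.trans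
    (h.2 m n _ (Diagram.mk' _ _ hwf) (C.map (Node.rename σ)) ?_ rfl rfl)
    (h'.2 m n _ _ (C.map (Node.rename σ)) rfl ?_ ?_)
  · simp [Diagram.rename, Diagram.mk', hD, hLfix]
  · simp [Diagram.rename, Diagram.mk', hD', hRfix]
  · simp [Diagram.rename, Diagram.mk', hb]

lemma fuse {α β γ : Real.Angle} (A B S : Multiset ℕ) {L M N : Multiset ℕ} (hS : S ≠ 0)
    (hL : L = A + S) (hM : M = B + S) (hN : N = A + B) (hγ : γ = α + β)
    (hc : Compat (L + M) N) : Derivable {.z α L, .z β M} {.z γ N} := by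
  subst hL hM hN hγ
  exact of_rule (.f α β A B S hS) (by simpa [Multiset.insert_eq_cons] using hc)

end Derivable

/-! ### Fresh legs and fusion of X-spiders -/

lemma ends_hads (l : Multiset (ℕ × ℕ)) :
    ends (l.map fun p => Node.had s(p.1, p.2)) = l.map Prod.fst + l.map Prod.snd := by
  induction l using Multiset.induction_on with
  | empty => rfl
  | cons p l ih =>
    simp only [Multiset.map_cons, ends_cons, ih, legs_had]
    simp only [Multiset.insert_eq_cons, ← Multiset.singleton_add]
    abel

/-- Distinct new names, from `K` on, for the elements of `A`. -/
lemma exists_zip (A : Multiset ℕ) (K : ℕ) : ∃ l : Multiset (ℕ × ℕ), l.map Prod.fst = A ∧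
    (∀ a, (l.map Prod.snd).count a ≤ 1) ∧
    ∀ a, (l.map Prod.snd).count a ≠ 0 → K ≤ a ∧ a < K + A.card := by
  induction A using Quotient.inductionOn with | _ A =>
  refine ⟨(A.zipIdx K : List (ℕ × ℕ)), by simp, fun a => ?_, fun a h => ?_⟩
  · simpa using List.nodup_iff_count_le_one.1 (List.nodup_range' (s := K) (n := A.length)) a
  · obtain ⟨i, hi, rfl⟩ : ∃ i < A.length, a = K + i := by simpa using h
    exact ⟨by omega, by simpa using hi⟩

namespace Derivable

/-- Colour change on both spiders puts two boxes on the shared wire; they cancel, the Z-spiders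
fuse, and the colour is changed back. -/
lemma xfuse (α β : Real.Angle) (A B : Multiset ℕ) (s : ℕ) (hc : ∀ a, (A + B).count a ≤ 2)
    (hs : s ∉ A + B) :
    Derivable {.x α (s ::ₘ A), .x β (s ::ₘ B)} {.x (α + β) (A + B)} := by
  obtain ⟨K, hK⟩ := exists_bound (s ::ₘ (A + B))
  -- `K` and `K + 1` are kept for the inner legs on the shared wire.
  obtain ⟨l, hl, hl1, hl2⟩ := exists_zip A (K + 2)
  obtain ⟨r, hr, hr1, hr2⟩ := exists_zip B (K + 2 + A.card)
  have hsK : s < K := hK s (by simp)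
  have facts : ∀ a, A.count a + B.count a ≤ 2 ∧ (A.count a + B.count a ≠ 0 → a < K ∧ a ≠ s) := by
    intro a
    refine ⟨by simpa using hc a, fun h => ?_⟩
    have : a ∈ A + B := Multiset.count_ne_zero.1 (by rwa [Multiset.count_add])
    exact ⟨hK a (Multiset.mem_cons_of_mem this), by rintro rfl; exact hs this⟩
  let H := l.map fun p => Node.had s(p.1, p.2)
  let J := r.map fun p => Node.had s(p.1, p.2)
  have hH : ends H = A + l.map Prod.snd := by rw [ends_hads, hl]
  have hJ : ends J = B + r.map Prod.snd := by rw [ends_hads, hr]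
  have comp : ∀ M N : Multiset ℕ, (∀ a,
        A.count a + B.count a ≤ 2 → (A.count a + B.count a ≠ 0 → a < K ∧ a ≠ s) →
        (l.map Prod.snd).count a ≤ 1 →
        ((l.map Prod.snd).count a ≠ 0 → K + 2 ≤ a ∧ a < K + 2 + A.card) →
        (r.map Prod.snd).count a ≤ 1 →
        ((r.map Prod.snd).count a ≠ 0 →
          K + 2 + A.card ≤ a ∧ a < K + 2 + A.card + B.card) →
        M.count a ≤ 2 ∧ N.count a ≤ 2 ∧ (M.count a = 1 ↔ N.count a = 1)) → Compat M N :=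
    fun M N h => compat_iff.2 fun a =>
      h a (facts a).1 (facts a).2 (hl1 a) (hl2 a) (hr1 a) (hr2 a)
  have s1 : Derivable {.x α (s ::ₘ A), .x β (s ::ₘ B)}
      ({.z α (K ::ₘ l.map Prod.snd), .had s(s, K), .x β (s ::ₘ B)} + H) := by
    refine (of_rule (.h α ((s, K) ::ₘ l)) ?_).step {.x β (s ::ₘ B)} ?_ ?_ ?_
    · refine comp _ _ fun a _ _ _ _ _ _ => ?_
      simp only [Multiset.map_cons, ends_singleton, legs_x, ends_cons, legs_z, ends_hads, legs_had,
        Multiset.insert_eq_cons, Multiset.count_add, Multiset.count_cons, Multiset.count_singleton,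
        hl]
      split_ifs <;> omega
    · simp only [Multiset.map_cons, hl]; rfl
    · simp only [Multiset.map_cons, H]
      simp only [Multiset.insert_eq_cons, ← Multiset.singleton_add]
      abel
    · refine comp _ _ fun a _ _ _ _ _ _ => ?_
      simp only [ends_add, hH, ends_singleton, legs_x, ends_cons, legs_z, legs_had,
        Multiset.insert_eq_cons, Multiset.count_add, Multiset.count_cons, Multiset.count_singleton]
      split_ifs <;> omega
  have s2 : Derivable ({.z α (K ::ₘ l.map Prod.snd), .had s(s, K), .x β (s ::ₘ B)} + H)
      ({.z α (K ::ₘ l.map Prod.snd), .had s(s, K), .had s(s, K + 1),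
        .z β ((K + 1) ::ₘ r.map Prod.snd)} + H + J) := by
    refine (of_rule (.h β ((s, K + 1) ::ₘ r)) ?_).step
      ({.z α (K ::ₘ l.map Prod.snd), .had s(s, K)} + H) ?_ ?_ ?_
    · refine comp _ _ fun a _ _ _ _ _ _ => ?_
      simp only [Multiset.map_cons, ends_singleton, legs_x, ends_cons, legs_z, ends_hads, legs_had,
        Multiset.insert_eq_cons, Multiset.count_add, Multiset.count_cons, Multiset.count_singleton,
        hr]
      split_ifs <;> omega
    · simp only [Multiset.map_cons, hr]
      simp only [Multiset.insert_eq_cons, ← Multiset.singleton_add]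
      abel
    · simp only [Multiset.map_cons, J]
      simp only [Multiset.insert_eq_cons, ← Multiset.singleton_add]
      abel
    · refine comp _ _ fun a _ _ _ _ _ _ => ?_
      simp only [ends_add, hH, hJ, ends_singleton, legs_x, ends_cons, legs_z, legs_had,
        Multiset.insert_eq_cons, Multiset.count_add, Multiset.count_cons, Multiset.count_singleton]
      split_ifs <;> omega
  have s3 : Derivable ({.z α (K ::ₘ l.map Prod.snd), .had s(s, K), .had s(s, K + 1),
        .z β ((K + 1) ::ₘ r.map Prod.snd)} + H + J)
      ({.z α (K ::ₘ l.map Prod.snd), .seg s(K, K + 1),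
        .z β ((K + 1) ::ₘ r.map Prod.snd)} + H + J) := by
    refine (of_rule (.i2 K (K + 1) s) ?_).step
      ({.z α (K ::ₘ l.map Prod.snd), .z β ((K + 1) ::ₘ r.map Prod.snd)} + H + J) ?_ ?_ ?_
    · refine comp _ _ fun a _ _ _ _ _ _ => ?_
      simp only [ends_singleton, ends_cons, legs_had, legs_seg,
        Multiset.insert_eq_cons, Multiset.count_add, Multiset.count_cons, Multiset.count_singleton]
      split_ifs <;> omega
    · rw [Sym2.eq_swap (a := K)]
      simp only [Multiset.insert_eq_cons, ← Multiset.singleton_add]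
      abel
    · simp only [Multiset.insert_eq_cons, ← Multiset.singleton_add]
      abel
    · refine comp _ _ fun a _ _ _ _ _ _ => ?_
      simp only [ends_add, hH, hJ, ends_singleton, ends_cons, legs_z, legs_had, legs_seg,
        Multiset.insert_eq_cons, Multiset.count_add, Multiset.count_cons, Multiset.count_singleton]
      split_ifs <;> omega
  -- Read as a phase-free Z-spider, the bare wire can be absorbed by fusion instead of
  -- straightening.
  have s4 : Derivable ({.z α (K ::ₘ l.map Prod.snd), .seg s(K, K + 1),
        .z β ((K + 1) ::ₘ r.map Prod.snd)} + H + J)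
      ({.z α (K ::ₘ l.map Prod.snd), .z 0 {K, K + 1},
        .z β ((K + 1) ::ₘ r.map Prod.snd)} + H + J) := by
    refine (of_rule (.i1 K (K + 1)) ?_).symm.step
      ({.z α (K ::ₘ l.map Prod.snd), .z β ((K + 1) ::ₘ r.map Prod.snd)} + H + J) ?_ ?_ ?_
    · refine comp _ _ fun a _ _ _ _ _ _ => ?_
      simp only [ends_singleton, legs_z, legs_seg,
        Multiset.insert_eq_cons, Multiset.count_cons, Multiset.count_singleton, iff_self,
        and_true]
      split_ifs <;> omega
    · simp only [Multiset.insert_eq_cons, ← Multiset.singleton_add]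
      abel
    · simp only [Multiset.insert_eq_cons, ← Multiset.singleton_add]
      abel
    · refine comp _ _ fun a _ _ _ _ _ _ => ?_
      simp only [ends_add, hH, hJ, ends_singleton, ends_cons, legs_z, legs_seg,
        Multiset.insert_eq_cons, Multiset.count_add, Multiset.count_cons, Multiset.count_singleton,
          iff_self,
        and_true]
      split_ifs <;> omega
  have s5 : Derivable ({.z α (K ::ₘ l.map Prod.snd), .z 0 {K, K + 1},
        .z β ((K + 1) ::ₘ r.map Prod.snd)} + H + J)
      ({.z α ((K + 1) ::ₘ l.map Prod.snd), .z β ((K + 1) ::ₘ r.map Prod.snd)} + H + J) := by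
    refine (fuse (α := α) (β := 0) (γ := α) (L := K ::ₘ l.map Prod.snd) (M := {K, K + 1})
      (N := (K + 1) ::ₘ l.map Prod.snd) (l.map Prod.snd) {K + 1} {K} (by simp) ?_ ?_ ?_
      (by simp) ?_).step ({.z β ((K + 1) ::ₘ r.map Prod.snd)} + H + J) ?_ ?_ ?_
    · simp only [← Multiset.singleton_add]
      abel
    · simp only [Multiset.insert_eq_cons, ← Multiset.singleton_add]
      abel
    · simp only [← Multiset.singleton_add]
      abel
    · refine comp _ _ fun a _ _ _ _ _ _ => ?_
      simp only [Multiset.insert_eq_cons, Multiset.count_add, Multiset.count_cons,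
        Multiset.count_singleton]
      split_ifs <;> omega
    · simp only [Multiset.insert_eq_cons, ← Multiset.singleton_add]
      abel
    · simp only [Multiset.insert_eq_cons, ← Multiset.singleton_add]
      abel
    · refine comp _ _ fun a _ _ _ _ _ _ => ?_
      simp only [ends_add, hH, hJ, ends_singleton, ends_cons, legs_z,
        Multiset.insert_eq_cons, Multiset.count_add, Multiset.count_cons, Multiset.count_singleton]
      split_ifs <;> omega
  have s6 : Derivable
      ({.z α ((K + 1) ::ₘ l.map Prod.snd), .z β ((K + 1) ::ₘ r.map Prod.snd)} + H + J)
      ({.z (α + β) (l.map Prod.snd + r.map Prod.snd)} + H + J) := by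
    refine (fuse (α := α) (β := β) (l.map Prod.snd) (r.map Prod.snd) {K + 1} (by simp) ?_ ?_ rfl
      rfl ?_).step (H + J) (add_assoc _ _ _) (add_assoc _ _ _) ?_
    · simp only [← Multiset.singleton_add]
      abel
    · simp only [← Multiset.singleton_add]
      abel
    · refine comp _ _ fun a _ _ _ _ _ _ => ?_
      simp only [Multiset.count_add, Multiset.count_cons]
      split_ifs <;> omega
    · refine comp _ _ fun a _ _ _ _ _ _ => ?_
      simp only [ends_add, hH, hJ, ends_singleton, ends_cons, legs_z,
        Multiset.insert_eq_cons, Multiset.count_add, Multiset.count_cons]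
      split_ifs <;> omega
  have s7 : Derivable {.x (α + β) (A + B)}
      ({.z (α + β) (l.map Prod.snd + r.map Prod.snd)} + H + J) := by
    have h0 := Rule.h (α + β) (l + r)
    simp only [Multiset.map_add, hl, hr, ← Multiset.singleton_add] at h0
    rw [add_assoc]
    refine of_rule h0 (comp _ _ fun a _ _ _ _ _ _ => ?_)
    simp only [ends_add, hH, hJ, ends_singleton, legs_z, legs_x, Multiset.count_add]
    omega
  exact s1.trans <| s2.trans <| s3.trans <| s4.trans <| s5.trans <| s6.trans s7.symm

lemma xfuse' {α β γ : Real.Angle} (A B : Multiset ℕ) (s : ℕ) {L M N : Multiset ℕ}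
    (hL : L = s ::ₘ A) (hM : M = s ::ₘ B) (hN : N = A + B) (hγ : γ = α + β)
    (hc : ∀ a ∈ A + B, (A + B).count a ≤ 2) (hs : s ∉ A + B) :
    Derivable {.x α L, .x β M} {.x γ N} := by
  subst hL hM hN hγ
  refine xfuse α β A B s (fun a => ?_) hs
  by_cases ha : a ∈ A + B
  · exact hc a ha
  · simp [Multiset.count_eq_zero.2 ha]

lemma copy {L : Multiset ℕ} (a b c : ℕ) (hL : L = {c, a, b})
    (hc : Compat ({c} + L) ({a} + {b})) : Derivable {.x 0 {c}, .z 0 L} {.x 0 {a}, .x 0 {b}} := by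
  subst hL
  exact of_rule (.c 0 c {a, b}) (by simpa using hc)

lemma bialgebra {L₁ L₂ M₁ M₂ L M : Multiset ℕ} (a₁ a₂ b₁ b₂ p q r s c : ℕ)
    (h₁ : L₁ = {a₁, p, q}) (h₂ : L₂ = {a₂, r, s}) (h₃ : M₁ = {p, r, b₁}) (h₄ : M₂ = {q, s, b₂})
    (h₅ : M = {a₁, a₂, c}) (h₆ : L = {c, b₁, b₂})
    (hc : Compat (L₁ + (L₂ + (M₁ + M₂))) (M + L)) :
    Derivable {.z 0 L₁, .z 0 L₂, .x 0 M₁, .x 0 M₂} {.x 0 M, .z 0 L} := by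
  subst h₁ h₂ h₃ h₄ h₅ h₆
  exact of_rule (.b a₁ a₂ b₁ b₂ p q r s c) (by simpa using hc)

/-! ### The Hopf law -/

/-- First evaluation: bialgebra on the first two CNOTs (joined along wires 5 and 7), then fusion
with the state on wire 0 and with the third CNOT (wire 10). The doubled connection of the Hopf law
appears. -/
lemma three_cnots_left : Derivable {.x 0 {0}, .z 0 {0, 4, 5}, .x 0 {1, 5, 6}, .x 0 {4, 7, 8}, .z 0
  {6, 7, 9}, .z 0 {8, 10, 2}, .x 0 {9, 10, 3}}
    {.z 0 {1, 2, 10, 11}, .x 0 {3, 10, 11}} := by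
  have h1 : Derivable {.x 0 {0}, .z 0 {0, 4, 5}, .x 0 {1, 5, 6}, .x 0 {4, 7, 8}, .z 0
    {6, 7, 9}, .z 0 {8, 10, 2}, .x 0 {9, 10, 3}}
      {.x 0 {0, 9, 11}, .z 0 {11, 8, 1}, .x 0 {0}, .z 0 {8, 10, 2}, .x 0 {9, 10, 3}} := by
    refine (show Derivable {.z 0 {0, 4, 5}, .z 0 {6, 7, 9}, .x 0 {4, 7, 8}, .x 0 {1, 5, 6}} {.x 0
      {0, 9, 11}, .z 0 {11, 8, 1}} from
      bialgebra 0 9 8 1 4 5 7 6 11 (by decide) (by decide) (by decide) (by decide) (by decide)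
        (by decide) (by decide)).step {.x 0 {0}, .z 0 {8, 10, 2}, .x 0 {9, 10, 3}} ?_ rfl
        (by simp; decide)
    simp only [Multiset.insert_eq_cons, ← Multiset.singleton_add]
    abel
  have h2 : Derivable {.x 0 {0, 9, 11}, .z 0 {11, 8, 1}, .x 0 {0}, .z 0 {8, 10, 2}, .x 0 {9, 10, 3}}
      {.x 0 {9, 11}, .z 0 {11, 8, 1}, .z 0 {8, 10, 2}, .x 0 {9, 10, 3}} := by
    refine (show Derivable {.x 0 {0}, .x 0 {0, 9, 11}} {.x 0 {9, 11}} from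
      xfuse' 0 {9, 11} 0 (by decide) (by decide) (by decide) (by simp) (by decide) (by decide)).step
        {.z 0 {11, 8, 1}, .z 0 {8, 10, 2}, .x 0 {9, 10, 3}} ?_ rfl (by simp; decide)
    simp only [Multiset.insert_eq_cons, ← Multiset.singleton_add]
    abel
  have h3 : Derivable {.x 0 {9, 11}, .z 0 {11, 8, 1}, .z 0 {8, 10, 2}, .x 0 {9, 10, 3}}
      {.x 0 {3, 10, 11}, .z 0 {11, 8, 1}, .z 0 {8, 10, 2}} := by
    refine (show Derivable {.x 0 {9, 11}, .x 0 {9, 10, 3}} {.x 0 {3, 10, 11}} from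
      xfuse' {11} {10, 3} 9 (by decide) (by decide) (by decide) (by simp) (by decide)
        (by decide)).step {.z 0 {11, 8, 1}, .z 0 {8, 10, 2}} ?_ rfl (by simp; decide)
    simp only [Multiset.insert_eq_cons, ← Multiset.singleton_add]
    abel
  have h4 : Derivable {.x 0 {3, 10, 11}, .z 0 {11, 8, 1}, .z 0 {8, 10, 2}}
      {.z 0 {1, 2, 10, 11}, .x 0 {3, 10, 11}} := by
    refine (show Derivable {.z 0 {11, 8, 1}, .z 0 {8, 10, 2}} {.z 0 {1, 2, 10, 11}} from
      fuse {1, 11} {10, 2} {8} (by decide) (by decide) (by decide) (by decide) (by simp)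
        (by decide)).step {.x 0 {3, 10, 11}} ?_ rfl (by simp; decide)
    simp only [Multiset.insert_eq_cons, ← Multiset.singleton_add]
    abel
  exact h1.trans (h2.trans (h3.trans h4))

/-- Second evaluation: bialgebra on the last two CNOTs, after which the one-legged X-spider is
copied through both Z-spiders. Three alternating CNOTs act as a swap: the state leaves at 3, and 1
is joined to 2. -/
lemma three_cnots_right : Derivable {.x 0 {0}, .z 0 {0, 4, 5}, .x 0 {1, 5, 6}, .x 0 {4, 7, 8}, .z 0
  {6, 7, 9}, .z 0 {8, 10, 2}, .x 0 {9, 10, 3}}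
    {.x 0 {1, 2}, .x 0 {3}} := by
  have h1 : Derivable {.x 0 {0}, .z 0 {0, 4, 5}, .x 0 {1, 5, 6}, .x 0 {4, 7, 8}, .z 0
    {6, 7, 9}, .z 0 {8, 10, 2}, .x 0 {9, 10, 3}}
      {.x 0 {6, 2, 11}, .z 0 {11, 4, 3}, .x 0 {0}, .z 0 {0, 4, 5}, .x 0 {1, 5, 6}} := by
    refine (show Derivable {.z 0 {6, 7, 9}, .z 0 {8, 10, 2}, .x 0 {4, 7, 8}, .x 0 {9, 10, 3}} {.x 0
      {6, 2, 11}, .z 0 {11, 4, 3}} from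
      bialgebra 6 2 4 3 7 9 8 10 11 (by decide) (by decide) (by decide) (by decide) (by decide)
        (by decide) (by decide)).step {.x 0 {0}, .z 0 {0, 4, 5}, .x 0 {1, 5, 6}} ?_ rfl
        (by simp; decide)
    simp only [Multiset.insert_eq_cons, ← Multiset.singleton_add]
    abel
  have h2 : Derivable {.x 0 {6, 2, 11}, .z 0 {11, 4, 3}, .x 0 {0}, .z 0 {0, 4, 5}, .x 0 {1, 5, 6}}
      {.x 0 {4}, .x 0 {5}, .x 0 {6, 2, 11}, .z 0 {11, 4, 3}, .x 0 {1, 5, 6}} := by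
    refine (show Derivable {.x 0 {0}, .z 0 {0, 4, 5}} {.x 0 {4}, .x 0 {5}} from
      copy 4 5 0 (by decide) (by decide)).step {.x 0 {6, 2, 11}, .z 0 {11, 4, 3}, .x 0 {1, 5, 6}}
        ?_ rfl (by simp; decide)
    simp only [Multiset.insert_eq_cons, ← Multiset.singleton_add]
    abel
  have h3 : Derivable {.x 0 {4}, .x 0 {5}, .x 0 {6, 2, 11}, .z 0 {11, 4, 3}, .x 0 {1, 5, 6}}
      {.x 0 {11}, .x 0 {3}, .x 0 {5}, .x 0 {6, 2, 11}, .x 0 {1, 5, 6}} := by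
    refine (show Derivable {.x 0 {4}, .z 0 {11, 4, 3}} {.x 0 {11}, .x 0 {3}} from
      copy 11 3 4 (by decide) (by decide)).step {.x 0 {5}, .x 0 {6, 2, 11}, .x 0 {1, 5, 6}} ?_ rfl
        (by simp; decide)
    simp only [Multiset.insert_eq_cons, ← Multiset.singleton_add]
    abel
  have h4 : Derivable {.x 0 {11}, .x 0 {3}, .x 0 {5}, .x 0 {6, 2, 11}, .x 0 {1, 5, 6}}
      {.x 0 {1, 6}, .x 0 {11}, .x 0 {3}, .x 0 {6, 2, 11}} := by
    refine (show Derivable {.x 0 {5}, .x 0 {1, 5, 6}} {.x 0 {1, 6}} from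
      xfuse' 0 {1, 6} 5 (by decide) (by decide) (by decide) (by simp) (by decide) (by decide)).step
        {.x 0 {11}, .x 0 {3}, .x 0 {6, 2, 11}} ?_ rfl (by simp; decide)
    simp only [Multiset.insert_eq_cons, ← Multiset.singleton_add]
    abel
  have h5 : Derivable {.x 0 {1, 6}, .x 0 {11}, .x 0 {3}, .x 0 {6, 2, 11}}
      {.x 0 {6, 2}, .x 0 {1, 6}, .x 0 {3}} := by
    refine (show Derivable {.x 0 {11}, .x 0 {6, 2, 11}} {.x 0 {6, 2}} from
      xfuse' 0 {6, 2} 11 (by decide) (by decide) (by decide) (by simp) (by decide) (by decide)).step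
        {.x 0 {1, 6}, .x 0 {3}} ?_ rfl (by simp; decide)
    simp only [Multiset.insert_eq_cons, ← Multiset.singleton_add]
    abel
  have h6 : Derivable {.x 0 {6, 2}, .x 0 {1, 6}, .x 0 {3}}
      {.x 0 {1, 2}, .x 0 {3}} := by
    refine (show Derivable {.x 0 {1, 6}, .x 0 {6, 2}} {.x 0 {1, 2}} from
      xfuse' {1} {2} 6 (by decide) (by decide) (by decide) (by simp) (by decide) (by decide)).step
        {.x 0 {3}} ?_ rfl (by simp; decide)
    simp only [Multiset.insert_eq_cons, ← Multiset.singleton_add]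
    abel
  exact h1.trans (h2.trans (h3.trans (h4.trans (h5.trans h6))))

/-- After colour change a phase-free Z-spider separates two boxes. Unfolding one box lets its outer
spider absorb the separator; folded again, the boxes are adjacent and cancel. -/
lemma x_two_legs : Derivable {.x 0 {1, 2}}
    {.z 0 {1, 2}} := by
  have h1 : Derivable {.x 0 {1, 2}}
      {.z 0 {3, 4}, .had s(1, 3), .had s(2, 4)} := by
    refine (show Derivable {.x 0 {1, 2}} {.z 0 {3, 4}, .had s(1, 3), .had s(2, 4)} from
      of_rule (.h 0 {(1, 3), (2, 4)}) (by simp; decide)).step 0 rfl rfl (by simp; decide)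
  have h2 : Derivable {.z 0 {3, 4}, .had s(1, 3), .had s(2, 4)}
      {.z (Real.pi / 2 : ℝ) {1, 5}, .x (Real.pi / 2 : ℝ) {5, 6}, .z (Real.pi / 2 : ℝ) {6, 3}, .z 0
        {3, 4}, .had s(2, 4)} := by
    refine (show Derivable {.had s(1, 3)} {.z (Real.pi / 2 : ℝ) {1, 5}, .x (Real.pi / 2 : ℝ)
      {5, 6}, .z (Real.pi / 2 : ℝ) {6, 3}} from
      of_rule (.hdef 1 3 5 6) (by simp; decide)).step {.z 0 {3, 4}, .had s(2, 4)} ?_ rfl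
        (by simp; decide)
    simp only [Multiset.insert_eq_cons, ← Multiset.singleton_add]
    abel
  have h3 : Derivable {.z (Real.pi / 2 : ℝ) {1, 5}, .x (Real.pi / 2 : ℝ)
    {5, 6}, .z (Real.pi / 2 : ℝ) {6, 3}, .z 0 {3, 4}, .had s(2, 4)}
      {.z (Real.pi / 2 : ℝ) {6, 4}, .z (Real.pi / 2 : ℝ) {1, 5}, .x (Real.pi / 2 : ℝ)
        {5, 6}, .had s(2, 4)} := by
    refine (show Derivable {.z (Real.pi / 2 : ℝ) {6, 3}, .z 0 {3, 4}} {.z (Real.pi / 2 : ℝ)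
      {6, 4}} from
      fuse {6} {4} {3} (by decide) (by decide) (by decide) (by decide) (by simp) (by decide)).step
        {.z (Real.pi / 2 : ℝ) {1, 5}, .x (Real.pi / 2 : ℝ) {5, 6}, .had s(2, 4)} ?_ rfl
        (by simp; decide)
    simp only [Multiset.insert_eq_cons, ← Multiset.singleton_add]
    abel
  have h4 : Derivable {.z (Real.pi / 2 : ℝ) {6, 4}, .z (Real.pi / 2 : ℝ)
    {1, 5}, .x (Real.pi / 2 : ℝ) {5, 6}, .had s(2, 4)}
      {.had s(1, 4), .had s(2, 4)} := by
    refine (show Derivable {.had s(1, 4)} {.z (Real.pi / 2 : ℝ) {1, 5}, .x (Real.pi / 2 : ℝ)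
      {5, 6}, .z (Real.pi / 2 : ℝ) {6, 4}} from
      of_rule (.hdef 1 4 5 6) (by simp; decide)).symm.step {.had s(2, 4)} ?_ rfl (by simp; decide)
    simp only [Multiset.insert_eq_cons, ← Multiset.singleton_add]
    abel
  have h5 : Derivable {.had s(1, 4), .had s(2, 4)}
      {.seg s(1, 2)} := by
    refine (show Derivable {.had s(1, 4), .had s(2, 4)} {.seg s(1, 2)} from by
        rw [Sym2.eq_swap (a := 2)]
        exact of_rule (.i2 1 2 4) (by simp; decide)).step 0 rfl rfl (by simp; decide)
  have h6 : Derivable {.seg s(1, 2)}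
      {.z 0 {1, 2}} := by
    refine (show Derivable {.z 0 {1, 2}} {.seg s(1, 2)} from
      of_rule (.i1 1 2) (by simp; decide)).symm.step 0 rfl rfl (by simp; decide)
  exact h1.trans (h2.trans (h3.trans (h4.trans (h5.trans h6))))

/-- An extra leg 2, capped by a one-legged Z-spider, produces the common shape of the two CNOT
evaluations. On the disconnected side the cap fuses back. -/
lemma hopf : Derivable {.z 0 {1, 10, 11}, .x 0 {3, 10, 11}}
    {.z 0 {1}, .x 0 {3}} := by
  have h1 : Derivable {.z 0 {1, 10, 11}, .x 0 {3, 10, 11}}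
      {.z 0 {1, 2, 10, 11}, .z 0 {2}, .x 0 {3, 10, 11}} := by
    refine (show Derivable {.z 0 {1, 2, 10, 11}, .z 0 {2}} {.z 0 {1, 10, 11}} from
      fuse {1, 10, 11} 0 {2} (by decide) (by decide) (by decide) (by decide) (by simp)
        (by decide)).symm.step {.x 0 {3, 10, 11}} rfl rfl (by simp; decide)
  have h2 : Derivable {.z 0 {1, 2, 10, 11}, .z 0 {2}, .x 0 {3, 10, 11}}
      {.x 0 {0}, .z 0 {0, 4, 5}, .x 0 {1, 5, 6}, .x 0 {4, 7, 8}, .z 0 {6, 7, 9}, .z 0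
        {8, 10, 2}, .x 0 {9, 10, 3}, .z 0 {2}} := by
    refine three_cnots_left.symm.step {.z 0 {2}} ?_ rfl (by simp; decide)
    simp only [Multiset.insert_eq_cons, ← Multiset.singleton_add]
    abel
  have h3 : Derivable {.x 0 {0}, .z 0 {0, 4, 5}, .x 0 {1, 5, 6}, .x 0 {4, 7, 8}, .z 0
    {6, 7, 9}, .z 0 {8, 10, 2}, .x 0 {9, 10, 3}, .z 0 {2}}
      {.x 0 {1, 2}, .x 0 {3}, .z 0 {2}} := by
    refine three_cnots_right.step {.z 0 {2}} rfl rfl (by simp; decide)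
  have h4 : Derivable {.x 0 {1, 2}, .x 0 {3}, .z 0 {2}}
      {.z 0 {1, 2}, .x 0 {3}, .z 0 {2}} := by
    refine (show Derivable {.x 0 {1, 2}} {.z 0 {1, 2}} from
      x_two_legs).step {.x 0 {3}, .z 0 {2}} rfl rfl (by simp; decide)
  have h5 : Derivable {.z 0 {1, 2}, .x 0 {3}, .z 0 {2}}
      {.z 0 {1}, .x 0 {3}} := by
    refine (show Derivable {.z 0 {1, 2}, .z 0 {2}} {.z 0 {1}} from
      fuse {1} 0 {2} (by decide) (by decide) (by decide) (by decide) (by simp) (by decide)).step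
        {.x 0 {3}} ?_ rfl (by simp; decide)
    simp only [Multiset.insert_eq_cons, ← Multiset.singleton_add]
    abel
  exact h1.trans (h2.trans (h3.trans (h4.trans h5)))

/-! ### Parallel edges and loops in concrete pictures -/

/-- A pair of boxes inserted on leg 2 puts a box on every leg of the second spider, which thereby
becomes an X-spider doubly joined to the first; then the Hopf law applies. -/
lemma parallel : Derivable {.z 0 {1, 10, 11}, .z 0 {2, 4, 5}, .had s(10, 4), .had s(11, 5)}
    {.z 0 {2}, .z 0 {1}} := by
  have h1 : Derivable {.z 0 {1, 10, 11}, .z 0 {2, 4, 5}, .had s(10, 4), .had s(11, 5)}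
      {.z 0 {6, 4, 5}, .z 0 {6, 2}, .z 0 {1, 10, 11}, .had s(10, 4), .had s(11, 5)} := by
    refine (show Derivable {.z 0 {6, 4, 5}, .z 0 {6, 2}} {.z 0 {2, 4, 5}} from
      fuse {4, 5} {2} {6} (by decide) (by decide) (by decide) (by decide) (by simp)
        (by decide)).symm.step {.z 0 {1, 10, 11}, .had s(10, 4), .had s(11, 5)} ?_ rfl
        (by simp; decide)
    simp only [Multiset.insert_eq_cons, ← Multiset.singleton_add]
    abel
  have h2 : Derivable {.z 0 {6, 4, 5}, .z 0 {6, 2}, .z 0 {1, 10, 11}, .had s(10, 4), .had s(11, 5)}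
      {.seg s(6, 2), .z 0 {6, 4, 5}, .z 0 {1, 10, 11}, .had s(10, 4), .had s(11, 5)} := by
    refine (show Derivable {.z 0 {6, 2}} {.seg s(6, 2)} from
      of_rule (.i1 6 2) (by simp; decide)).step {.z 0 {6, 4, 5}, .z 0
        {1, 10, 11}, .had s(10, 4), .had s(11, 5)} ?_ rfl (by simp; decide)
    simp only [Multiset.insert_eq_cons, ← Multiset.singleton_add]
    abel
  have h3 : Derivable {.seg s(6, 2), .z 0 {6, 4, 5}, .z 0 {1, 10, 11}, .had s(10, 4), .had s(11, 5)}
      {.had s(6, 3), .had s(3, 2), .z 0 {6, 4, 5}, .z 0 {1, 10, 11}, .had s(10, 4), .had s(11,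
        5)} := by
    refine (show Derivable {.had s(6, 3), .had s(3, 2)} {.seg s(6, 2)} from
      of_rule (.i2 6 2 3) (by simp; decide)).symm.step {.z 0 {6, 4, 5}, .z 0
        {1, 10, 11}, .had s(10, 4), .had s(11, 5)} rfl rfl (by simp; decide)
  have h4 : Derivable {.had s(6, 3), .had s(3, 2), .z 0 {6, 4, 5}, .z 0
    {1, 10, 11}, .had s(10, 4), .had s(11, 5)}
      {.x 0 {3, 10, 11}, .had s(3, 2), .z 0 {1, 10, 11}} := by
    refine (show Derivable {.x 0 {3, 10, 11}} {.z 0 {6, 4, 5}, .had s(6, 3), .had s(10, 4),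
      .had s(11, 5)} from by
        rw [Sym2.eq_swap (a := 6)]
        exact of_rule (.h 0 {(3, 6), (10, 4), (11, 5)}) (by simp; decide)).symm.step
          {.had s(3, 2), .z 0 {1, 10, 11}} ?_ rfl (by simp; decide)
    simp only [Multiset.insert_eq_cons, ← Multiset.singleton_add]
    abel
  have h5 : Derivable {.x 0 {3, 10, 11}, .had s(3, 2), .z 0 {1, 10, 11}}
      {.z 0 {1}, .x 0 {3}, .had s(3, 2)} := by
    refine (show Derivable {.z 0 {1, 10, 11}, .x 0 {3, 10, 11}} {.z 0 {1}, .x 0 {3}} from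
      hopf).step {.had s(3, 2)} ?_ rfl (by simp; decide)
    simp only [Multiset.insert_eq_cons, ← Multiset.singleton_add]
    abel
  have h6 : Derivable {.z 0 {1}, .x 0 {3}, .had s(3, 2)}
      {.z 0 {8}, .had s(8, 3), .z 0 {1}, .had s(3, 2)} := by
    refine (show Derivable {.x 0 {3}} {.z 0 {8}, .had s(8, 3)} from by
        rw [Sym2.eq_swap (a := 8)]
        exact of_rule (.h 0 {(3, 8)}) (by simp; decide)).step {.z 0 {1}, .had s(3, 2)} ?_ rfl
          (by simp; decide)
    simp only [Multiset.insert_eq_cons, ← Multiset.singleton_add]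
    abel
  have h7 : Derivable {.z 0 {8}, .had s(8, 3), .z 0 {1}, .had s(3, 2)}
      {.seg s(8, 2), .z 0 {8}, .z 0 {1}} := by
    refine (show Derivable {.had s(8, 3), .had s(3, 2)} {.seg s(8, 2)} from
      of_rule (.i2 8 2 3) (by simp; decide)).step {.z 0 {8}, .z 0 {1}} ?_ rfl (by simp; decide)
    simp only [Multiset.insert_eq_cons, ← Multiset.singleton_add]
    abel
  have h8 : Derivable {.seg s(8, 2), .z 0 {8}, .z 0 {1}}
      {.z 0 {8, 2}, .z 0 {8}, .z 0 {1}} := by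
    refine (show Derivable {.z 0 {8, 2}} {.seg s(8, 2)} from
      of_rule (.i1 8 2) (by simp; decide)).symm.step {.z 0 {8}, .z 0 {1}} rfl rfl (by simp; decide)
  have h9 : Derivable {.z 0 {8, 2}, .z 0 {8}, .z 0 {1}}
      {.z 0 {2}, .z 0 {1}} := by
    refine (show Derivable {.z 0 {8}, .z 0 {8, 2}} {.z 0 {2}} from
      fuse 0 {2} {8} (by decide) (by decide) (by decide) (by decide) (by simp) (by decide)).step
        {.z 0 {1}} ?_ rfl (by simp; decide)
    simp only [Multiset.insert_eq_cons, ← Multiset.singleton_add]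
    abel
  exact h1.trans (h2.trans (h3.trans (h4.trans (h5.trans (h6.trans (h7.trans (h8.trans h9)))))))

/-- In the unfolded box the two outer Z-spiders fuse into the given one, adding `π/2` each, and the
middle X-spider is left doubly connected. The phases are split off and the Hopf law disconnects it,
leaving a scalar. -/
lemma loop : Derivable {.z 0 {2, 4, 5}, .had s(4, 5)}
    {.z (Real.pi / 2 : ℝ) 0, .z ((Real.pi / 2 : ℝ) + (Real.pi / 2 : ℝ)) {2}} := by
  have h1 : Derivable {.z 0 {2, 4, 5}, .had s(4, 5)}
      {.z (Real.pi / 2 : ℝ) {4, 10}, .x (Real.pi / 2 : ℝ) {10, 11}, .z (Real.pi / 2 : ℝ)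
        {11, 5}, .z 0 {2, 4, 5}} := by
    refine (show Derivable {.had s(4, 5)} {.z (Real.pi / 2 : ℝ) {4, 10}, .x (Real.pi / 2 : ℝ)
      {10, 11}, .z (Real.pi / 2 : ℝ) {11, 5}} from
      of_rule (.hdef 4 5 10 11) (by simp; decide)).step {.z 0 {2, 4, 5}} ?_ rfl (by simp; decide)
    simp only [Multiset.insert_eq_cons, ← Multiset.singleton_add]
    abel
  have h2 : Derivable {.z (Real.pi / 2 : ℝ) {4, 10}, .x (Real.pi / 2 : ℝ)
    {10, 11}, .z (Real.pi / 2 : ℝ) {11, 5}, .z 0 {2, 4, 5}}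
      {.z (Real.pi / 2 : ℝ) {2, 5, 10}, .x (Real.pi / 2 : ℝ) {10, 11}, .z (Real.pi / 2 : ℝ)
        {11, 5}} := by
    refine (show Derivable {.z 0 {2, 4, 5}, .z (Real.pi / 2 : ℝ) {4, 10}} {.z (Real.pi / 2 : ℝ)
      {2, 5, 10}} from
      fuse {2, 5} {10} {4} (by decide) (by decide) (by decide) (by decide) (by simp)
        (by decide)).step {.x (Real.pi / 2 : ℝ) {10, 11}, .z (Real.pi / 2 : ℝ) {11, 5}} ?_ rfl
        (by simp; decide)
    simp only [Multiset.insert_eq_cons, ← Multiset.singleton_add]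
    abel
  have h3 : Derivable {.z (Real.pi / 2 : ℝ) {2, 5, 10}, .x (Real.pi / 2 : ℝ)
    {10, 11}, .z (Real.pi / 2 : ℝ) {11, 5}}
      {.z ((Real.pi / 2 : ℝ) + (Real.pi / 2 : ℝ)) {2, 10, 11}, .x (Real.pi / 2 : ℝ) {10, 11}} := by
    refine (show Derivable {.z (Real.pi / 2 : ℝ) {2, 5, 10}, .z (Real.pi / 2 : ℝ) {11, 5}}
      {.z ((Real.pi / 2 : ℝ) + (Real.pi / 2 : ℝ)) {2, 10, 11}} from
      fuse {2, 10} {11} {5} (by decide) (by decide) (by decide) (by decide) (by simp)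
        (by decide)).step {.x (Real.pi / 2 : ℝ) {10, 11}} ?_ rfl (by simp; decide)
    simp only [Multiset.insert_eq_cons, ← Multiset.singleton_add]
    abel
  have h4 : Derivable {.z ((Real.pi / 2 : ℝ) + (Real.pi / 2 : ℝ)) {2, 10, 11}, .x (Real.pi / 2 : ℝ)
    {10, 11}}
      {.z ((Real.pi / 2 : ℝ) + (Real.pi / 2 : ℝ)) {1, 2}, .z 0 {1, 10, 11}, .x (Real.pi / 2 : ℝ)
        {10, 11}} := by
    refine (show Derivable {.z ((Real.pi / 2 : ℝ) + (Real.pi / 2 : ℝ)) {1, 2}, .z 0 {1, 10, 11}}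
      {.z ((Real.pi / 2 : ℝ) + (Real.pi / 2 : ℝ)) {2, 10, 11}} from
      fuse {2} {10, 11} {1} (by decide) (by decide) (by decide) (by decide) (by simp)
        (by decide)).symm.step {.x (Real.pi / 2 : ℝ) {10, 11}} rfl rfl (by simp; decide)
  have h5 : Derivable {.z ((Real.pi / 2 : ℝ) + (Real.pi / 2 : ℝ)) {1, 2}, .z 0
    {1, 10, 11}, .x (Real.pi / 2 : ℝ) {10, 11}}
      {.x 0 {3, 10, 11}, .x (Real.pi / 2 : ℝ) {3}, .z ((Real.pi / 2 : ℝ) + (Real.pi / 2 : ℝ))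
        {1, 2}, .z 0 {1, 10, 11}} := by
    refine (show Derivable {.x 0 {3, 10, 11}, .x (Real.pi / 2 : ℝ) {3}} {.x (Real.pi / 2 : ℝ)
      {10, 11}} from
      xfuse' {10, 11} 0 3 (by decide) (by decide) (by decide) (by simp) (by decide)
        (by decide)).symm.step {.z ((Real.pi / 2 : ℝ) + (Real.pi / 2 : ℝ)) {1, 2}, .z 0 {1, 10, 11}}
        ?_ rfl (by simp; decide)
    simp only [Multiset.insert_eq_cons, ← Multiset.singleton_add]
    abel
  have h6 : Derivable {.x 0 {3, 10, 11}, .x (Real.pi / 2 : ℝ)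
    {3}, .z ((Real.pi / 2 : ℝ) + (Real.pi / 2 : ℝ)) {1, 2}, .z 0 {1, 10, 11}}
      {.z 0 {1}, .x 0 {3}, .x (Real.pi / 2 : ℝ) {3}, .z ((Real.pi / 2 : ℝ) + (Real.pi / 2 : ℝ))
        {1, 2}} := by
    refine (show Derivable {.z 0 {1, 10, 11}, .x 0 {3, 10, 11}} {.z 0 {1}, .x 0 {3}} from
      hopf).step {.x (Real.pi / 2 : ℝ) {3}, .z ((Real.pi / 2 : ℝ) + (Real.pi / 2 : ℝ)) {1, 2}}
        ?_ rfl (by simp; decide)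
    simp only [Multiset.insert_eq_cons, ← Multiset.singleton_add]
    abel
  have h7 : Derivable {.z 0 {1}, .x 0 {3}, .x (Real.pi / 2 : ℝ)
    {3}, .z ((Real.pi / 2 : ℝ) + (Real.pi / 2 : ℝ)) {1, 2}}
      {.z ((Real.pi / 2 : ℝ) + (Real.pi / 2 : ℝ)) {2}, .x 0 {3}, .x (Real.pi / 2 : ℝ) {3}} := by
    refine (show Derivable {.z ((Real.pi / 2 : ℝ) + (Real.pi / 2 : ℝ)) {1, 2}, .z 0 {1}}
      {.z ((Real.pi / 2 : ℝ) + (Real.pi / 2 : ℝ)) {2}} from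
      fuse {2} 0 {1} (by decide) (by decide) (by decide) (by decide) (by simp) (by decide)).step
        {.x 0 {3}, .x (Real.pi / 2 : ℝ) {3}} ?_ rfl (by simp; decide)
    simp only [Multiset.insert_eq_cons, ← Multiset.singleton_add]
    abel
  have h8 : Derivable {.z ((Real.pi / 2 : ℝ) + (Real.pi / 2 : ℝ)) {2}, .x 0
    {3}, .x (Real.pi / 2 : ℝ) {3}}
      {.x (Real.pi / 2 : ℝ) 0, .z ((Real.pi / 2 : ℝ) + (Real.pi / 2 : ℝ)) {2}} := by
    refine (show Derivable {.x (Real.pi / 2 : ℝ) {3}, .x 0 {3}} {.x (Real.pi / 2 : ℝ) 0} from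
      xfuse' 0 0 3 (by decide) (by decide) (by decide) (by simp) (by decide) (by decide)).step
        {.z ((Real.pi / 2 : ℝ) + (Real.pi / 2 : ℝ)) {2}} ?_ rfl (by simp; decide)
    simp only [Multiset.insert_eq_cons, ← Multiset.singleton_add]
    abel
  have h9 : Derivable {.x (Real.pi / 2 : ℝ) 0, .z ((Real.pi / 2 : ℝ) + (Real.pi / 2 : ℝ)) {2}}
      {.z (Real.pi / 2 : ℝ) 0, .z ((Real.pi / 2 : ℝ) + (Real.pi / 2 : ℝ)) {2}} := by
    refine (show Derivable {.x (Real.pi / 2 : ℝ) 0} {.z (Real.pi / 2 : ℝ) 0} from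
      of_rule (.h (Real.pi / 2 : ℝ) 0) (by simp; decide)).step
        {.z ((Real.pi / 2 : ℝ) + (Real.pi / 2 : ℝ)) {2}} rfl rfl (by simp; decide)
  exact h1.trans (h2.trans (h3.trans (h4.trans (h5.trans (h6.trans (h7.trans (h8.trans h9)))))))

/-! ### Unfolding boxes, wires and X-spiders -/

lemma add_fresh {L R : Multiset Node} (h : Derivable L R) (X : Multiset Node)
    (hX : ∀ a, (ends L).count a + (ends X).count a ≤ 2)
    (hf : ∀ a ∈ ends R, a ∉ ends L → a ∉ ends X) : Derivable (L + X) (R + X) := by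
  refine h.add X (compat_iff.2 fun a => ?_)
  have h1 := compat_iff.1 h.1 a
  have h2 := hX a
  have h3 := hf a
  rw [← Multiset.count_pos, ← Multiset.count_eq_zero, ← Multiset.count_eq_zero] at h3
  rw [ends_add, ends_add, Multiset.count_add, Multiset.count_add]
  omega

/-- The Hadamard box as a chain of spiders and Hadamard edges. -/
noncomputable def gadget (a b c d e f : ℕ) : Multiset Node :=
  {.z (Real.pi / 2 : ℝ) {a, c}, .had s(c, d), .z (Real.pi / 2 : ℝ) {d, e}, .had s(f, e),
    .z (Real.pi / 2 : ℝ) {f, b}}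

/-- Definition of the box, followed by colour change of its middle X-spider. Both resulting boxes
lie between Z-spiders regardless of what `a` and `b` are attached to. -/
lemma had_gadget (a b K : ℕ) (ha : a < K) (hb : b < K) :
    Derivable {.had s(a, b)} (gadget a b K (K + 1) (K + 2) (K + 3)) := by
  have s1 : Derivable {.had s(a, b)} {.z (Real.pi / 2 : ℝ) {a, K},
      .x (Real.pi / 2 : ℝ) {K, K + 3}, .z (Real.pi / 2 : ℝ) {K + 3, b}} := by
    refine of_rule (.hdef a b K (K + 3)) (compat_iff.2 fun x => ?_)
    simp only [ends_singleton, ends_cons, legs_z, legs_had, legs_x, Multiset.insert_eq_cons,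
      Multiset.count_add, Multiset.count_cons, Multiset.count_singleton]
    split_ifs <;> omega
  refine s1.trans ((of_rule (.h (Real.pi / 2 : ℝ) {(K, K + 1), (K + 3, K + 2)}) ?_).step
    {.z (Real.pi / 2 : ℝ) {a, K}, .z (Real.pi / 2 : ℝ) {K + 3, b}} ?_ ?_ ?_)
  · refine compat_iff.2 fun x => ?_
    simp only [ends_singleton, ends_cons, legs_z, legs_had, legs_x, Multiset.insert_eq_cons,
      Multiset.count_add, Multiset.count_cons, Multiset.count_singleton, Multiset.map_cons,
      Multiset.map_singleton]
    split_ifs <;> omega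
  · simp only [Multiset.insert_eq_cons, Multiset.map_cons, Multiset.map_singleton]
    simp only [← Multiset.singleton_add]
    abel
  · simp only [Multiset.insert_eq_cons, Multiset.map_cons, Multiset.map_singleton, gadget]
    simp only [← Multiset.singleton_add]
    abel
  · refine compat_iff.2 fun x => ?_
    simp only [ends_singleton, ends_cons, legs_z, legs_had, legs_x, Multiset.insert_eq_cons,
      Multiset.count_add, Multiset.count_cons, Multiset.count_singleton, gadget]
    split_ifs <;> omega

/-- A bare wire is two boxes in a row. Unfolding both leaves at each end a two-legged spider whose
other leg is at a box. -/
lemma seg_gadget (a b K : ℕ) (ha : a < K) (hb : b < K) :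
    Derivable {.seg s(a, b)} (gadget a K (K + 1) (K + 2) (K + 3) (K + 4) +
      gadget K b (K + 5) (K + 6) (K + 7) (K + 8)) := by
  have s1 : Derivable {.seg s(a, b)} {.had s(a, K), .had s(K, b)} := by
    refine (of_rule (.i2 a b K) (compat_iff.2 fun x => ?_)).symm
    simp only [ends_singleton, ends_cons, legs_had, legs_seg, Multiset.insert_eq_cons,
      Multiset.count_add, Multiset.count_cons, Multiset.count_singleton]
    split_ifs <;> omega
  have s2 : Derivable ({.had s(a, K)} + {.had s(K, b)})
      (gadget a K (K + 1) (K + 2) (K + 3) (K + 4) + {.had s(K, b)}) := by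
    refine (had_gadget a K (K + 1) (by omega) (by omega)).add_fresh _ (fun x => ?_)
      fun x h1 h2 => ?_
    · simp only [ends_singleton, legs_had, Multiset.insert_eq_cons,
        Multiset.count_cons, Multiset.count_singleton]
      split_ifs <;> omega
    · simp [gadget] at h1 h2 ⊢
      omega
  have s3 : Derivable ({.had s(K, b)} + gadget a K (K + 1) (K + 2) (K + 3) (K + 4))
      (gadget K b (K + 5) (K + 6) (K + 7) (K + 8) +
        gadget a K (K + 1) (K + 2) (K + 3) (K + 4)) := by
    refine (had_gadget K b (K + 5) (by omega) (by omega)).add_fresh _ (fun x => ?_)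
      fun x h1 h2 => ?_
    · have := (compat_iff.1 s2.1 x).2.1
      rw [ends_add, Multiset.count_add] at this
      omega
    · simp [gadget] at h1 h2 ⊢
      omega
  rw [add_comm, add_comm (gadget K b _ _ _ _)] at s3
  exact s1.trans (s2.trans s3)

lemma x_gadget (α : Real.Angle) (L : Multiset ℕ) (K : ℕ) (hK : ∀ a ∈ L, a < K)
    (hL : ∀ a, L.count a ≤ 2) :
    ∃ l : Multiset (ℕ × ℕ), l.card = L.card ∧ (∀ a ∈ l.map Prod.snd, K ≤ a) ∧
      l.map Prod.fst = L ∧ Derivable {.x α L}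
        ({.z α (l.map Prod.snd)} + l.map fun p => .had s(p.1, p.2)) := by
  obtain ⟨l, hl, hl1, hl2⟩ := exists_zip L K
  refine ⟨l, by rw [← hl, Multiset.card_map], fun a ha => (hl2 a ?_).1, hl, ?_⟩
  · exact Multiset.count_ne_zero.2 ha
  have h := Rule.h α l
  rw [hl] at h
  refine of_rule h (compat_iff.2 fun a => ?_)
  simp only [ends_singleton, ends_add, legs_z, legs_x, ends_hads, hl, Multiset.count_add]
  have h1 := hl1 a
  have h2 := hl2 a
  have h3 := hL a
  have h4 : L.count a ≠ 0 → a < K := fun h => hK a (Multiset.count_ne_zero.1 h)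
  omega

/-! ### Loops and parallel edges at arbitrary spiders -/

/-- Unfusion isolates the two legs of the loop on a phase-free three-legged spider, to which a
renamed `loop` applies; the remainder fuses back. -/
lemma had_loop (α : Real.Angle) (A : Multiset ℕ) (a b : ℕ) (hab : a ≠ b)
    (hA : ∀ x, A.count x ≤ 2) (ha : a ∉ A) (hb : b ∉ A) :
    Derivable {.z α (a ::ₘ b ::ₘ A), .had s(a, b)}
      {.z (α + ((Real.pi / 2 : ℝ) + (Real.pi / 2 : ℝ))) A, .z (Real.pi / 2 : ℝ) 0} := by
  obtain ⟨K, hK⟩ := exists_bound (a ::ₘ b ::ₘ A)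
  have haK := hK a (by simp)
  have hbK := hK b (by simp)
  have ha' := Multiset.count_eq_zero.2 ha
  have hb' := Multiset.count_eq_zero.2 hb
  have hKA : ∀ x, A.count x ≠ 0 → x < K ∧ x ≠ a ∧ x ≠ b := fun x h =>
    ⟨hK x (by simp [Multiset.count_ne_zero.1 h]), by rintro rfl; exact h ha',
      by rintro rfl; exact h hb'⟩
  -- `loop` uses only the names 2, 4 and 5, so the default branch is the image of 2.
  have core := loop.rename (fun i => if i = 4 then a else if i = 5 then b else K) (by
    intro i hi j hj h
    simp at hi hj
    rcases hi with rfl | rfl | rfl <;> rcases hj with rfl | rfl | rfl <;> simp at h ⊢ <;> omega)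
  simp [Node.rename] at core
  have s1 : Derivable {.z α (a ::ₘ b ::ₘ A), .had s(a, b)}
      {.z α (K ::ₘ A), .z 0 {K, a, b}, .had s(a, b)} := by
    refine (fuse (α := α) (β := 0) (L := K ::ₘ A) (M := {K, a, b}) A {a, b} {K} (by simp)
      ?_ ?_ ?_ (by simp) (compat_iff.2 fun x => ?_)).symm.step {.had s(a, b)} rfl rfl
      (compat_iff.2 fun x => ?_)
    · simp only [← Multiset.singleton_add]
      abel
    · simp only [Multiset.insert_eq_cons, ← Multiset.singleton_add]
      abel
    · simp only [Multiset.insert_eq_cons, ← Multiset.singleton_add]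
      abel
    all_goals
      have h1 := hA x
      have h2 := hKA x
      simp only [ends_singleton, ends_cons, legs_z, legs_had, Multiset.insert_eq_cons,
        Multiset.count_add, Multiset.count_cons, Multiset.count_singleton]
      split_ifs <;> omega
  have s2 : Derivable {.z α (K ::ₘ A), .z 0 {K, a, b}, .had s(a, b)}
      {.z α (K ::ₘ A), .z ((Real.pi / 2 : ℝ) + (Real.pi / 2 : ℝ)) {K},
        .z (Real.pi / 2 : ℝ) 0} := by
    refine core.step {.z α (K ::ₘ A)} ?_ ?_ (compat_iff.2 fun x => ?_)
    · simp only [Multiset.insert_eq_cons, ← Multiset.singleton_add]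
      abel
    · simp only [Multiset.insert_eq_cons, ← Multiset.singleton_add]
      abel
    · have h1 := hA x
      have h2 := hKA x
      simp only [ends_singleton, ends_cons, legs_z, legs_had, Multiset.insert_eq_cons,
        Multiset.count_add, Multiset.count_cons, Multiset.count_singleton, Multiset.count_zero]
      split_ifs <;> omega
  refine s1.trans (s2.trans ((fuse (L := K ::ₘ A) (M := {K}) A 0 {K} (by simp)
    ?_ ?_ ?_ rfl (compat_iff.2 fun x => ?_)).step {.z (Real.pi / 2 : ℝ) 0} rfl rfl
      (compat_iff.2 fun x => ?_)))
  · simp only [← Multiset.singleton_add]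
    abel
  · simp
  · simp
  all_goals
    have h1 := hA x
    have h2 := hKA x
    simp only [ends_singleton, ends_cons, legs_z, Multiset.insert_eq_cons,
      Multiset.count_add, Multiset.count_cons, Multiset.count_singleton, Multiset.count_zero]
    split_ifs <;> omega

lemma had_parallel (α β : Real.Angle) (A B : Multiset ℕ) (a b c d : ℕ)
    (hd : [a, b, c, d].Nodup) (hA : ∀ x, A.count x + B.count x ≤ 2)
    (hs : ∀ x ∈ [a, b, c, d], A.count x + B.count x = 0) :
    Derivable {.z α (a ::ₘ c ::ₘ A), .z β (b ::ₘ d ::ₘ B), .had s(a, b), .had s(c, d)}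
      {.z α A, .z β B} := by
  obtain ⟨K, hK⟩ := exists_bound (a ::ₘ b ::ₘ c ::ₘ d ::ₘ (A + B))
  have haK := hK a (by simp)
  have hbK := hK b (by simp)
  have hcK := hK c (by simp)
  have hdK := hK d (by simp)
  have hKA : ∀ x, A.count x + B.count x ≠ 0 → x < K ∧ x ≠ a ∧ x ≠ b ∧ x ≠ c ∧ x ≠ d := by
    intro x h
    have : x ∈ A + B := Multiset.count_ne_zero.1 (by rwa [Multiset.count_add])
    refine ⟨hK x (by simp at this ⊢; tauto), ?_, ?_, ?_, ?_⟩ <;>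
    · rintro rfl
      exact h (hs x (by simp))
  simp only [List.nodup_cons, List.mem_cons, List.not_mem_nil, or_false, not_or] at hd
  -- Of the dangling and box names of `parallel`, only 5 is left for the default branch.
  have core := parallel.rename (fun i => if i = 1 then K else if i = 10 then a else
    if i = 11 then c else if i = 2 then K + 1 else if i = 4 then b else d) (by
    intro i hi j hj h
    simp at hi hj
    rcases hi with rfl | rfl | rfl | rfl | rfl | rfl <;>
      rcases hj with rfl | rfl | rfl | rfl | rfl | rfl <;> simp at h ⊢ <;> omega)
  simp [Node.rename] at core
  have s1 : Derivable
      {.z α (a ::ₘ c ::ₘ A), .z β (b ::ₘ d ::ₘ B), .had s(a, b), .had s(c, d)}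
      {.z α (K ::ₘ A), .z 0 {K, a, c}, .z β (b ::ₘ d ::ₘ B), .had s(a, b), .had s(c, d)} := by
    refine (fuse (α := α) (β := 0) (L := K ::ₘ A) (M := {K, a, c}) A {a, c} {K} (by simp)
      ?_ ?_ ?_ (by simp) (compat_iff.2 fun x => ?_)).symm.step
      {.z β (b ::ₘ d ::ₘ B), .had s(a, b), .had s(c, d)} rfl rfl (compat_iff.2 fun x => ?_)
    · simp only [← Multiset.singleton_add]
      abel
    · simp only [Multiset.insert_eq_cons, ← Multiset.singleton_add]
      abel
    · simp only [Multiset.insert_eq_cons, ← Multiset.singleton_add]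
      abel
    all_goals
      have h1 := hA x
      have h2 := hKA x
      simp only [ends_singleton, ends_cons, legs_z, legs_had, Multiset.insert_eq_cons,
        Multiset.count_add, Multiset.count_cons, Multiset.count_singleton]
      split_ifs <;> omega
  have s2 : Derivable
      {.z α (K ::ₘ A), .z 0 {K, a, c}, .z β (b ::ₘ d ::ₘ B), .had s(a, b), .had s(c, d)}
      {.z β ((K + 1) ::ₘ B), .z 0 {K + 1, b, d}, .z α (K ::ₘ A), .z 0 {K, a, c},
        .had s(a, b), .had s(c, d)} := by
    refine (fuse (α := β) (β := 0) (γ := β) (L := (K + 1) ::ₘ B) (M := {K + 1, b, d})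
      (N := b ::ₘ d ::ₘ B) B {b, d} {K + 1}
      (by simp) ?_ ?_ ?_ (by simp) (compat_iff.2 fun x => ?_)).symm.step
      {.z α (K ::ₘ A), .z 0 {K, a, c}, .had s(a, b), .had s(c, d)} ?_ rfl
      (compat_iff.2 fun x => ?_)
    · simp only [← Multiset.singleton_add]
      abel
    · simp only [Multiset.insert_eq_cons, ← Multiset.singleton_add]
      abel
    · simp only [Multiset.insert_eq_cons, ← Multiset.singleton_add]
      abel
    on_goal 2 =>
      simp only [Multiset.insert_eq_cons, ← Multiset.singleton_add]
      abel
    all_goals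
      have h1 := hA x
      have h2 := hKA x
      simp only [ends_singleton, ends_cons, legs_z, legs_had, Multiset.insert_eq_cons,
        Multiset.count_add, Multiset.count_cons, Multiset.count_singleton]
      split_ifs <;> omega
  have s3 : Derivable {.z β ((K + 1) ::ₘ B), .z 0 {K + 1, b, d}, .z α (K ::ₘ A),
        .z 0 {K, a, c}, .had s(a, b), .had s(c, d)}
      {.z α (K ::ₘ A), .z 0 {K}, .z β ((K + 1) ::ₘ B), .z 0 {K + 1}} := by
    refine core.step {.z α (K ::ₘ A), .z β ((K + 1) ::ₘ B)} ?_ ?_ (compat_iff.2 fun x => ?_)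
    · simp only [Multiset.insert_eq_cons, ← Multiset.singleton_add]
      abel
    · simp only [Multiset.insert_eq_cons, ← Multiset.singleton_add]
      abel
    · have h1 := hA x
      have h2 := hKA x
      simp only [ends_singleton, ends_cons, legs_z, legs_had, Multiset.insert_eq_cons,
        Multiset.count_add, Multiset.count_cons, Multiset.count_singleton]
      split_ifs <;> omega
  have s4 : Derivable {.z α (K ::ₘ A), .z 0 {K}, .z β ((K + 1) ::ₘ B), .z 0 {K + 1}}
      {.z α A, .z β ((K + 1) ::ₘ B), .z 0 {K + 1}} := by
    refine (fuse (L := K ::ₘ A) (M := {K}) A 0 {K} (by simp) ?_ ?_ ?_ (by simp)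
      (compat_iff.2 fun x => ?_)).step {.z β ((K + 1) ::ₘ B), .z 0 {K + 1}} rfl rfl
      (compat_iff.2 fun x => ?_)
    · simp only [← Multiset.singleton_add]
      abel
    · simp
    · simp
    all_goals
      have h1 := hA x
      have h2 := hKA x
      simp only [ends_singleton, ends_cons, legs_z, Multiset.insert_eq_cons,
        Multiset.count_add, Multiset.count_cons, Multiset.count_singleton]
      split_ifs <;> omega
  refine s1.trans (s2.trans (s3.trans (s4.trans
    ((fuse (α := β) (β := 0) (γ := β) (L := (K + 1) ::ₘ B) (M := {K + 1}) (N := B) B 0 {K + 1}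
      (by simp) ?_ ?_ ?_ (by simp)
      (compat_iff.2 fun x => ?_)).step {.z α A} ?_ ?_ (compat_iff.2 fun x => ?_)))))
  · simp only [← Multiset.singleton_add]
    abel
  · simp
  · simp
  · have h1 := hA x
    have h2 := hKA x
    simp only [Multiset.count_add, Multiset.count_cons, Multiset.count_singleton]
    split_ifs <;> omega
  · simp only [Multiset.insert_eq_cons, ← Multiset.singleton_add]
    abel
  · simp only [Multiset.insert_eq_cons, ← Multiset.singleton_add]
    abel
  · have h1 := hA x
    have h2 := hKA x
    simp only [ends_singleton, ends_cons, legs_z, Multiset.insert_eq_cons,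
      Multiset.count_add, Multiset.count_cons, Multiset.count_singleton]
    split_ifs <;> omega

/-- Unfusing turns the loop into a second connection between two spiders, and the fusion rule then
contracts both wires at once. -/
lemma plain_loop (α : Real.Angle) (A : Multiset ℕ) (a : ℕ)
    (hA : ∀ x, A.count x ≤ 2) (ha : a ∉ A) :
    Derivable {.z α (a ::ₘ a ::ₘ A)} {.z α A} := by
  obtain ⟨K, hK⟩ := exists_bound (a ::ₘ A)
  have haK := hK a (by simp)
  have ha' := Multiset.count_eq_zero.2 ha
  have hKA : ∀ x, A.count x ≠ 0 → x < K ∧ x ≠ a := fun x h =>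
    ⟨hK x (by simp [Multiset.count_ne_zero.1 h]), by rintro rfl; exact h ha'⟩
  refine (fuse (α := α) (β := 0) (L := K ::ₘ a ::ₘ A) (M := {K, a}) (a ::ₘ A) {a} {K} (by simp)
      ?_ ?_ ?_ (by simp) (compat_iff.2 fun x => ?_)).symm.trans
    (fuse A 0 {K, a} (by simp) ?_ ?_ ?_ (by simp) (compat_iff.2 fun x => ?_))
  case refine_4 | refine_8 =>
    have h1 := hA x
    have h2 := hKA x
    simp only [Multiset.insert_eq_cons, Multiset.count_add, Multiset.count_cons,
      Multiset.count_singleton]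
    split_ifs <;> omega
  all_goals
    simp only [Multiset.insert_eq_cons, ← Multiset.singleton_add, add_zero, zero_add] <;> abel

end Derivable

/-! ### Reduction to Z-spiders with attached boxes -/

/-- The ends of wires that lie on Z-spiders. -/
def zSpiderEnds (N : Multiset Node) : Multiset ℕ := N.bind Node.zLegs

@[simp] lemma zSpiderEnds_zero : zSpiderEnds 0 = 0 := rfl
@[simp] lemma zSpiderEnds_add (M N : Multiset Node) : zSpiderEnds
  (M + N) = zSpiderEnds M + zSpiderEnds N :=
  Multiset.add_bind ..
@[simp] lemma zSpiderEnds_cons (v : Node) (N : Multiset Node) :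
    zSpiderEnds (v ::ₘ N) = v.zLegs + zSpiderEnds N := Multiset.cons_bind ..
@[simp] lemma zSpiderEnds_singleton (v : Node) : zSpiderEnds
  {v} = v.zLegs := Multiset.singleton_bind ..
@[simp] lemma zLegs_z (α L) : (Node.z α L).zLegs = L := rfl
@[simp] lemma zLegs_had (e) : (Node.had e).zLegs = 0 := rfl

lemma mem_zSpiderEnds {N : Multiset Node} {a : ℕ} : a ∈ zSpiderEnds N ↔ ∃ α L,
  .z α L ∈ N ∧ a ∈ L := by
  simp only [zSpiderEnds, Multiset.mem_bind]
  constructor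
  · rintro ⟨v, hv, ha⟩
    cases v with
    | z α L => exact ⟨α, L, hv, ha⟩
    | _ => simp [Node.zLegs] at ha
  · rintro ⟨α, L, hv, ha⟩
    exact ⟨_, hv, ha⟩

lemma zSpiderEnds_le_ends (N : Multiset Node) : zSpiderEnds N ≤ ends N := by
  induction N using Multiset.induction_on with
  | empty => simp
  | cons v N ih =>
    rw [zSpiderEnds_cons, ends_cons]
    refine add_le_add ?_ ih
    cases v <;> simp [Node.zLegs, Node.legs]

/-- The nodes are Z-spiders, and Hadamard boxes attached to these. -/
def Reduced (N : Multiset Node) : Prop :=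
  ∀ v ∈ N, (∃ α L, v = .z α L) ∨ ∃ a b, v = .had s(a, b) ∧ a ∈ zSpiderEnds N ∧ b ∈ zSpiderEnds N

lemma Reduced.add {M N : Multiset Node} (hM : Reduced M) (hN : Reduced N) :
    Reduced (M + N) := by
  intro v hv
  rcases Multiset.mem_add.1 hv with hv | hv
  · rcases hM v hv with h | ⟨a, b, h, ha, hb⟩
    · exact .inl h
    · exact .inr ⟨a, b, h, by simp [ha], by simp [hb]⟩
  · rcases hN v hv with h | ⟨a, b, h, ha, hb⟩
    · exact .inl h
    · exact .inr ⟨a, b, h, by simp [ha], by simp [hb]⟩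

lemma reduced_z (α : Real.Angle) (L : Multiset ℕ) : Reduced {.z α L} := by
  intro v hv
  exact .inl ⟨α, L, Multiset.mem_singleton.1 hv⟩

lemma reduced_gadget (a b c d e f : ℕ) : Reduced (Derivable.gadget a b c d e f) := by
  intro v hv
  simp only [Derivable.gadget, Multiset.insert_eq_cons, Multiset.mem_cons,
    Multiset.mem_singleton] at hv
  rcases hv with rfl | rfl | rfl | rfl | rfl
  · exact .inl ⟨_, _, rfl⟩
  · exact .inr ⟨_, _, rfl, by simp [Derivable.gadget], by simp [Derivable.gadget]⟩
  · exact .inl ⟨_, _, rfl⟩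
  · exact .inr ⟨_, _, rfl, by simp [Derivable.gadget], by simp [Derivable.gadget]⟩
  · exact .inl ⟨_, _, rfl⟩

/-- The number of steps needed to reduce a node. -/
def Node.weight : Node → ℕ
  | z _ _ => 1
  | x _ L => L.card + 2
  | had _ => 1
  | seg _ => 1

namespace Diagram

variable {m n : ℕ}

lemma mem_bdry (b : Fin m ⊕ Fin n → ℕ) (p) : b p ∈ bdry b := by
  simp [bdry]

lemma apply_fresh {L R C : Multiset Node} {K : ℕ} (h : Derivable L R) (D : Diagram m n)
    (hD : D.nodes = L + C) (hK : ∀ a ∈ ends D.nodes + bdry D.boundary, a < K)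
    (hf : ∀ a ∈ ends R, a ∉ ends L → K ≤ a) :
    ∃ D' : Diagram m n, D'.nodes = R + C ∧ D'.boundary = D.boundary ∧ D.Equal D' := by
  refine h.apply D hD fun a ha hL => ?_
  have h1 := hf a ha hL
  refine ⟨fun h2 => ?_, fun p hp => ?_⟩
  · have := hK a (by simp [hD, h2])
    omega
  · have := hK a (by rw [← hp]; simp [mem_bdry])
    omega

/-- `P` is the finished part, `N` the nodes still to be treated. An X-spider returns its boxes to
`N`, so its weight must exceed their number; unfolded boxes go straight to `P`. -/
lemma exists_reduced_aux (k : ℕ) : ∀ (D : Diagram m n) (P N : Multiset Node),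
    D.nodes = P + N → Reduced P → (N.map Node.weight).sum ≤ k →
    ∃ D' : Diagram m n, D.Equal D' ∧ Reduced D'.nodes := by
  induction k with
  | zero =>
    intro D P N hD hP hk
    induction N using Multiset.induction_on with
    | empty => exact ⟨D, .refl D, by simpa [hD] using hP⟩
    | cons v N _ => cases v <;> simp [Node.weight] at hk
  | succ k ih =>
    intro D P N hD hP hk
    induction N using Multiset.induction_on with
    | empty => exact ⟨D, .refl D, by simpa [hD] using hP⟩
    | cons v N _ =>
      obtain ⟨K, hK⟩ := exists_bound (ends D.nodes + bdry D.boundary)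
      have hD' : D.nodes = {v} + (P + N) := by
        rw [hD, ← Multiset.singleton_add]
        abel
      have hv : ∀ a ∈ v.legs, a < K := fun a ha => hK a (by simp [hD, ha])
      rw [Multiset.map_cons, Multiset.sum_cons] at hk
      have key : ∀ R M : Multiset Node, Reduced R → (M.map Node.weight).sum < v.weight →
          Derivable {v} (R + M) → (∀ a ∈ ends (R + M), a ∉ v.legs → K ≤ a) →
          ∃ D' : Diagram m n, D.Equal D' ∧ Reduced D'.nodes := by
        intro R M hR hM h hf
        obtain ⟨D₁, hD₁, -, he⟩ := apply_fresh h D hD' hK (by simpa using hf)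
        obtain ⟨D₂, he', hD₂⟩ := ih D₁ (P + R) (M + N) (by rw [hD₁]; abel) (hP.add hR)
          (by rw [Multiset.map_add, Multiset.sum_add]; omega)
        exact ⟨D₂, he.trans he', hD₂⟩
      cases v with
      | z α L =>
        exact ih D (P + {.z α L}) N (by rw [hD, ← Multiset.singleton_add]; abel)
          (hP.add (reduced_z α L)) (by simp only [Node.weight] at hk; omega)
      | x α L =>
        obtain ⟨l, h1, h2, h3, h4⟩ := Derivable.x_gadget α L K hv fun a => by
          have := D.count_ends a
          rw [hD', ends_add, ends_singleton, legs_x, Multiset.count_add] at this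
          omega
        refine key _ _ (reduced_z _ _) ?_ h4 fun a ha hL => ?_
        · simp [Node.weight, Function.comp_def, h1]
        · rw [ends_add, ends_hads, h3, ends_singleton, legs_z, Multiset.mem_add,
            Multiset.mem_add] at ha
          rw [legs_x] at hL
          exact h2 a (by tauto)
      | had e =>
        induction e with | _ a b =>
        simp at hv
        refine key _ 0 (reduced_gadget _ _ _ _ _ _) (by simp [Node.weight])
          (by simpa using Derivable.had_gadget a b K hv.1 hv.2) fun x hx hL => ?_
        simp [Derivable.gadget] at hx hL
        omega
      | seg e =>
        induction e with | _ a b =>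
        simp at hv
        refine key {.z 0 {a, b}} 0 (reduced_z _ _) (by simp [Node.weight]) ?_ fun x hx hL => ?_
        · refine (Derivable.of_rule (.i1 a b) (compat_iff.2 fun x => ?_)).symm
          simp only [ends_singleton, legs_z, legs_seg,
            Multiset.insert_eq_cons, Multiset.count_cons, Multiset.count_singleton, iff_self,
            and_true]
          split_ifs <;> omega
        · simp at hx hL
          omega

lemma exists_reduced (D : Diagram m n) : ∃ D' : Diagram m n, D.Equal D' ∧ Reduced D'.nodes :=
  exists_reduced_aux _ D 0 D.nodes (by simp) (fun _ h => by simp at h) le_rfl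

/-! ### Isolating the inputs and outputs -/

/-- The input or output `p` is connected to a Z-spider whose only other leg is at a
Hadamard box. -/
def Isolated (D : Diagram m n) (p : Fin m ⊕ Fin n) : Prop :=
  ∃ α h k, .z α {h, D.boundary p} ∈ D.nodes ∧ .had s(h, k) ∈ D.nodes

lemma count_bdry_update (b : Fin m ⊕ Fin n → ℕ) (p) (K x : ℕ) :
    (bdry (Function.update b p K)).count x + (if x = b p then 1 else 0) =
      (bdry b).count x + (if x = K then 1 else 0) := by
  have h : (Finset.univ : Finset (Fin m ⊕ Fin n)).val =
      p ::ₘ ((Finset.univ : Finset (Fin m ⊕ Fin n)).erase p).val := by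
    rw [Finset.erase_val, Multiset.cons_erase (by simp)]
  have e : ((Finset.univ : Finset (Fin m ⊕ Fin n)).erase p).val.map (Function.update b p K) =
      ((Finset.univ : Finset (Fin m ⊕ Fin n)).erase p).val.map b :=
    Multiset.map_congr rfl fun q hq => by
      have : q ≠ p := Finset.ne_of_mem_erase (s := Finset.univ) hq
      simp [this]
  rw [bdry, bdry, h, Multiset.map_cons, Multiset.map_cons, e, Function.update_self,
    Multiset.count_cons, Multiset.count_cons]
  omega

/-- Straightening, used backwards, inserts a bare wire before each input or output, and `seg_gadget`
unfolds it. The rest of the diagram is unchanged, so those already treated stay isolated. -/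
lemma exists_isolated (D : Diagram m n) (hD : Reduced D.nodes) (S : Finset (Fin m ⊕ Fin n)) :
    ∃ D' : Diagram m n, D.Equal D' ∧ Reduced D'.nodes ∧ ∀ p ∈ S, D'.Isolated p := by
  induction S using Finset.induction_on with
  | empty => exact ⟨D, .refl D, hD, by simp⟩
  | insert p S hp ih =>
    obtain ⟨D₁, he, hr, hS⟩ := ih
    obtain ⟨K, hK⟩ := exists_bound (ends D₁.nodes + bdry D₁.boundary)
    have hb : ∀ q, D₁.boundary q < K := fun q => hK _ (by simp [mem_bdry])
    have hnK : ∀ a ∈ ends D₁.nodes, a < K := fun a ha => hK a (by simp [ha])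
    let D₂ : Diagram m n := mk' (.seg s(D₁.boundary p, K) ::ₘ D₁.nodes)
      (Function.update D₁.boundary p K) fun x => by
        have h1 := count_bdry_update D₁.boundary p K x
        have h2 := D₁.count_ends x
        have h3 : x = K → (ends D₁.nodes + bdry D₁.boundary).count x = 0 := by
          rintro rfl
          refine Multiset.count_eq_zero.2 fun h => ?_
          have := hK x h
          omega
        have h4 := hb p
        rw [Multiset.count_add] at h3
        simp only [ends_cons, legs_seg, Multiset.insert_eq_cons, Multiset.count_add,
          Multiset.count_cons, Multiset.count_singleton]
        split_ifs at h1 ⊢ <;> omega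
    have he₂ : D₂.Equal D₁ := by
      refine .rel _ _ (.straighten D₂ D₁ (D₁.boundary p) K (hb p).ne D₁.nodes rfl ?_ ?_)
      · refine (map_rename_eq_self fun a ha => ?_).symm
        have := hnK a ha
        simp [this.ne]
      · funext q
        have := (hb q).ne
        by_cases hq : q = p
        · subst hq
          simp [D₂, mk']
        · simp [D₂, mk', hq, this]
    -- The name `K` is now taken by the new boundary wire.
    obtain ⟨D₃, hn, hb₃, he₃⟩ := apply_fresh (K := K + 1)
      (Derivable.seg_gadget (D₁.boundary p) K (K + 1) (by have := hb p; omega) (by omega))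
      D₂ (C := D₁.nodes) rfl (fun a ha => by
        rw [Multiset.mem_add] at ha
        rcases ha with ha | ha
        · have h1 := hb p
          simp only [D₂, mk', ends_cons, legs_seg, Multiset.mem_add, Multiset.insert_eq_cons,
            Multiset.mem_cons, Multiset.mem_singleton] at ha
          rcases ha with (rfl | rfl) | ha
          · omega
          · omega
          · have := hnK a ha
            omega
        · obtain ⟨q, -, rfl⟩ := Multiset.mem_map.1 ha
          have := hb q
          by_cases hq : q = p
          · subst hq
            simp [D₂, mk']
          · simp only [D₂, mk', Function.update_of_ne hq]
            omega) (fun x hx hL => by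
        simp [Derivable.gadget] at hx hL
        omega)
    refine ⟨D₃, he.trans (he₂.symm.trans he₃), ?_, fun q hq => ?_⟩
    · rw [hn]
      exact ((reduced_gadget _ _ _ _ _ _).add (reduced_gadget _ _ _ _ _ _)).add hr
    · by_cases hqp : q = p
      · subst hqp
        -- The last spider of the second gadget and the box next to it.
        refine ⟨(Real.pi / 2 : ℝ), K + 1 + 8, K + 1 + 7, ?_, ?_⟩
        · rw [hn, hb₃]
          simp [D₂, mk', Derivable.gadget]
        · rw [hn]
          simp [Derivable.gadget]
      · obtain ⟨α, h, k, h1, h2⟩ := hS q (Finset.mem_of_mem_insert_of_ne hq hqp)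
        refine ⟨α, h, k, ?_, ?_⟩
        · rw [hn, hb₃]
          exact Multiset.mem_add.2 (.inr (by simpa [D₂, mk', hqp] using h1))
        · rw [hn]
          simp [h2]

/-! ### Simplifications away from the boundary -/

lemma count_le_two (D : Diagram m n) (a : ℕ) :
    (ends D.nodes).count a + (bdry D.boundary).count a ≤ 2 := by
  have := D.count_ends a
  omega

lemma one_le_count_bdry (b : Fin m ⊕ Fin n → ℕ) (p) : 1 ≤ (bdry b).count (b p) :=
  Multiset.one_le_count_iff_mem.2 (mem_bdry b p)

lemma two_le_count_bdry (b : Fin m ⊕ Fin n → ℕ) {p q} (hpq : p ≠ q) (h : b p = b q) :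
    2 ≤ (bdry b).count (b p) := by
  have h1 : ({p, q} : Finset (Fin m ⊕ Fin n)).val ≤ Finset.univ.val :=
    Finset.val_le_iff.2 (Finset.subset_univ _)
  have h2 := Multiset.count_le_of_le (b p) (Multiset.map_le_map (f := b) h1)
  have h3 : ({p, q} : Finset (Fin m ⊕ Fin n)).val = {p, q} := by
    rw [Finset.insert_val_of_notMem (by simpa using hpq)]
    rfl
  rw [h3] at h2
  simpa [Multiset.insert_eq_cons, h, bdry] using h2

/-- All nodes are Z-spiders or Hadamard edges, and the inputs and outputs are isolated. -/
structure Prepared (D : Diagram m n) : Prop where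
  reduced : Reduced D.nodes
  isolated : ∀ p, D.Isolated p

/-- The spider and the box use up both ends of `h`; the spider and the boundary use up both ends of
the boundary wire. -/
lemma isolated_legs {D : Diagram m n} {γ : Real.Angle} {h c : ℕ} {p}
    (hz : .z γ {h, D.boundary p} ∈ D.nodes) (hh : .had s(h, c) ∈ D.nodes) :
    h ≠ D.boundary p ∧ (zSpiderEnds D.nodes).count h = 1 ∧ (ends D.nodes).count h = 2 ∧
      (ends D.nodes).count (D.boundary p) = 1 ∧
      ∀ e, .had s(D.boundary p, e) ∉ D.nodes := by
  obtain ⟨N, hN⟩ := Multiset.exists_cons_of_mem hz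
  have hh' : Node.had s(h, c) ∈ N := by
    rw [hN] at hh
    simpa using hh
  obtain ⟨M, hM⟩ := Multiset.exists_cons_of_mem hh'
  rw [hM] at hN
  have h1 := D.count_le_two h
  have h2 := D.count_le_two (D.boundary p)
  have h3 := one_le_count_bdry D.boundary p
  have h4 := Multiset.count_le_of_le h (zSpiderEnds_le_ends M)
  have hne : h ≠ D.boundary p := by
    intro he
    rw [hN] at h2
    simp only [ends_cons, legs_z, legs_had, Multiset.insert_eq_cons, Multiset.count_add,
      Multiset.count_cons, Multiset.count_singleton, he] at h2
    simp at h2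
    omega
  refine ⟨hne, ?_, ?_, ?_, fun e he => ?_⟩
  · rw [hN] at h1 ⊢
    simp only [ends_cons, legs_z, legs_had, zSpiderEnds_cons, zLegs_z, zLegs_had,
      Multiset.insert_eq_cons, Multiset.count_add, Multiset.count_cons, Multiset.count_singleton,
      if_true, if_neg hne, Multiset.count_zero] at h1 ⊢
    omega
  · rw [hN] at h1 ⊢
    simp only [ends_cons, legs_z, legs_had,
      Multiset.insert_eq_cons, Multiset.count_add, Multiset.count_cons, Multiset.count_singleton,
      if_true, if_neg hne] at h1 ⊢
    omega
  · rw [hN] at h2 ⊢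
    simp only [ends_cons, legs_z, legs_had,
      Multiset.insert_eq_cons, Multiset.count_add, Multiset.count_cons, Multiset.count_singleton,
      if_true] at h2 ⊢
    omega
  · obtain ⟨N', hN'⟩ := Multiset.exists_cons_of_mem hz
    have he' : Node.had s(D.boundary p, e) ∈ N' := by
      rw [hN'] at he
      simpa using he
    obtain ⟨M', hM'⟩ := Multiset.exists_cons_of_mem he'
    rw [hN', hM'] at h2
    simp only [ends_cons, legs_z, legs_had,
      Multiset.insert_eq_cons, Multiset.count_add, Multiset.count_cons, Multiset.count_singleton,
      if_true] at h2
    omega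

/-- Common frame of the three moves: `hI` keeps the boundary spiders, and `hL` their boxes, out of
the replaced part. The number of wire ends at nodes is the termination measure. -/
lemma Prepared.replace {D : Diagram m n} (hP : D.Prepared) {L R C : Multiset Node}
    (h : Derivable L R) (hD : D.nodes = L + C) (hR : ∀ v ∈ R, ∃ α M, v = .z α M)
    (hs : ends R ≤ ends L)
    (hL : ∀ a b, .had s(a, b) ∈ L → a ∈ zSpiderEnds L)
    (hI : ∀ γ a p, .z γ {a, D.boundary p} ∈ L → ∀ c, .had s(a, c) ∉ D.nodes)
    (hc : (ends R).card < (ends L).card) :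
    ∃ D' : Diagram m n, D.Equal D' ∧ D'.Prepared ∧
      (ends D'.nodes).card < (ends D.nodes).card := by
  obtain ⟨D', hn, hb, he⟩ := h.apply D hD fun a ha hL => absurd (Multiset.mem_of_le hs ha) hL
  refine ⟨D', he, ⟨fun v hv => ?_, fun p => ?_⟩, ?_⟩
  · have key : ∀ a, a ∈ zSpiderEnds D.nodes → a ∈ ends C → a ∈ zSpiderEnds D'.nodes := by
      intro a ha haC
      rw [hD, zSpiderEnds_add, Multiset.mem_add] at ha
      rw [hn, zSpiderEnds_add, Multiset.mem_add]
      refine ha.imp_left fun haL => ?_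
      have h1 := Multiset.count_pos.2 (Multiset.mem_of_le (zSpiderEnds_le_ends L) haL)
      have h2 := Multiset.count_pos.2 haC
      have h3 := D.count_le_two a
      rw [hD, ends_add, Multiset.count_add] at h3
      have h4 := (compat_iff.1 h.1 a).2.2.1 (by omega)
      obtain ⟨v, hv, hav⟩ := mem_ends.1 (Multiset.count_pos.1 (by omega : 0 < (ends R).count a))
      obtain ⟨α, M, rfl⟩ := hR v hv
      exact mem_zSpiderEnds.2 ⟨α, M, hv, hav⟩
    rw [hn] at hv
    rcases Multiset.mem_add.1 hv with hv | hv
    · exact .inl (hR v hv)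
    · refine (hP.reduced v (by simp [hD, hv])).imp_right ?_
      rintro ⟨a, b, rfl, ha, hb⟩
      exact ⟨a, b, rfl, key a ha (mem_ends.2 ⟨_, hv, by simp⟩),
        key b hb (mem_ends.2 ⟨_, hv, by simp⟩)⟩
  · obtain ⟨γ, a, c, h1, h2⟩ := hP.isolated p
    have h3 : Node.z γ {a, D.boundary p} ∈ C := by
      have := h1
      rw [hD, Multiset.mem_add] at this
      exact this.resolve_left fun h => hI γ a p h c h2
    have h4 : Node.had s(a, c) ∈ C := by
      have := h2
      rw [hD, Multiset.mem_add] at this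
      refine this.resolve_left fun h => ?_
      have h5 := Multiset.count_pos.2 (hL a c h)
      -- If the box lay in `L`, the wire `a` would end on a Z-spider of `L` and on the boundary
      -- spider in `C`, against `isolated_legs`.
      have h6 : a ∈ zSpiderEnds C := mem_zSpiderEnds.2 ⟨_, _, h3, by simp⟩
      have h7 := Multiset.count_pos.2 h6
      have h8 := (isolated_legs h1 h2).2.1
      rw [hD, zSpiderEnds_add, Multiset.count_add] at h8
      omega
    exact ⟨γ, a, c, by rw [hn, hb]; exact Multiset.mem_add.2 (.inr h3),
      by rw [hn]; exact Multiset.mem_add.2 (.inr h4)⟩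
  · rw [hn, hD, ends_add, ends_add, Multiset.card_add, Multiset.card_add]
    omega

/-- The plain wire is a loop or joins two spiders. In the second case only `a` is contracted;
further shared wires become plain loops, which are again instances of this lemma. -/
lemma Prepared.fuse {D : Diagram m n} (hP : D.Prepared) {a : ℕ}
    (ha : 2 ≤ (zSpiderEnds D.nodes).count a) :
    ∃ D' : Diagram m n, D.Equal D' ∧ D'.Prepared ∧
      (ends D'.nodes).card < (ends D.nodes).card := by
  have hI : ∀ γ h p c, .z γ {h, D.boundary p} ∈ D.nodes → .had s(h, c) ∈ D.nodes →
      a ∉ ({h, D.boundary p} : Multiset ℕ) := by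
    intro γ h p c hz hh hm
    obtain ⟨-, h1, -, h2, -⟩ := isolated_legs hz hh
    have h3 := Multiset.count_le_of_le (D.boundary p) (zSpiderEnds_le_ends D.nodes)
    simp only [Multiset.insert_eq_cons, Multiset.mem_cons, Multiset.mem_singleton] at hm
    rcases hm with rfl | rfl <;> omega
  obtain ⟨α, L, hz, hL⟩ := mem_zSpiderEnds.1 (Multiset.count_pos.1
    (by omega : 0 < (zSpiderEnds D.nodes).count a))
  obtain ⟨C, hC⟩ := Multiset.exists_cons_of_mem hz
  obtain ⟨A, rfl⟩ := Multiset.exists_cons_of_mem hL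
  have hle : ∀ x, (ends D.nodes).count x ≤ 2 := fun x => by
    have := D.count_le_two x
    omega
  by_cases haA : a ∈ A
  · obtain ⟨A, rfl⟩ := Multiset.exists_cons_of_mem haA
    have hA : ∀ x, (a ::ₘ a ::ₘ A).count x ≤ 2 := fun x => by
      have := hle x
      rw [hC, ends_cons, Multiset.count_add] at this
      exact (Nat.le_add_right _ _).trans this
    refine hP.replace (Derivable.plain_loop α A a (fun x => ?_) fun h => ?_) (C := C)
      (by rw [hC, Multiset.singleton_add]) (by simp) ?_ (by simp) ?_ (by simp)
    · have := hA x
      simp only [Multiset.count_cons] at this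
      omega
    · have h1 := hA a
      have h2 := Multiset.count_pos.2 h
      simp only [Multiset.count_cons_self] at h1
      omega
    · simpa using (Multiset.le_cons_self A a).trans (Multiset.le_cons_self _ a)
    · intro γ h p hm c hc
      rw [Multiset.mem_singleton, Node.z.injEq] at hm
      exact hI γ h p c (by rw [hC, hm.1, hm.2]; simp) hc (by rw [hm.2]; simp)
  · have h1 : a ∈ zSpiderEnds C := by
      rw [← Multiset.count_pos]
      rw [hC, zSpiderEnds_cons, zLegs_z, Multiset.count_add, Multiset.count_cons_self,
        Multiset.count_eq_zero.2 haA] at ha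
      omega
    obtain ⟨β, M, hz', hM⟩ := mem_zSpiderEnds.1 h1
    obtain ⟨C, rfl⟩ := Multiset.exists_cons_of_mem hz'
    obtain ⟨B, rfl⟩ := Multiset.exists_cons_of_mem hM
    have hAB : ∀ x, (a ::ₘ A).count x + (a ::ₘ B).count x ≤ 2 := fun x => by
      have := hle x
      rw [hC, ends_cons, ends_cons, Multiset.count_add, Multiset.count_add] at this
      simp only [legs_z] at this
      omega
    refine hP.replace (Derivable.fuse (α := α) (β := β) (L := a ::ₘ A) (M := a ::ₘ B) A B {a}
        (by simp) ?_ ?_ rfl rfl (compat_iff.2 fun x => ?_)) (C := C)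
        (by simp only [hC, Multiset.insert_eq_cons, Multiset.cons_add, Multiset.singleton_add])
        (by simp) ?_ (by simp) ?_ (by simp)
    · rw [← Multiset.singleton_add, add_comm]
    · rw [← Multiset.singleton_add, add_comm]
    · have h2 := hAB x
      simp only [Multiset.count_add, Multiset.count_cons] at h2 ⊢
      split_ifs at h2 ⊢ <;> omega
    · simpa [Multiset.insert_eq_cons] using
        add_le_add (Multiset.le_cons_self A a) (Multiset.le_cons_self B a)
    · intro γ h p hm c hc
      simp only [Multiset.insert_eq_cons, Multiset.mem_cons, Multiset.mem_singleton,
        Node.z.injEq] at hm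
      rcases hm with hm | hm
      · exact hI γ h p c (by rw [hC, Multiset.insert_eq_cons, hm.1, hm.2]; simp) hc
          (by rw [Multiset.insert_eq_cons, hm.2]; simp)
      · exact hI γ h p c (by rw [hC, Multiset.insert_eq_cons, hm.1, hm.2]; simp) hc
          (by rw [Multiset.insert_eq_cons, hm.2]; simp)

/-- A spider attached to an input or output has at most one leg at a Hadamard box. -/
lemma isolated_had {D : Diagram m n} {γ : Real.Angle} {h p c a b x y}
    (hz : .z γ {h, D.boundary p} ∈ D.nodes) (hh : .had s(h, c) ∈ D.nodes)
    (ha : a ∈ ({h, D.boundary p} : Multiset ℕ)) (hb : b ∈ ({h, D.boundary p} : Multiset ℕ))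
    (hx : .had s(a, x) ∈ D.nodes) (hy : .had s(b, y) ∈ D.nodes) : a = b := by
  have h1 := (isolated_legs hz hh).2.2.2.2
  simp only [Multiset.insert_eq_cons, Multiset.mem_cons, Multiset.mem_singleton] at ha hb
  rcases ha with rfl | rfl
  · rcases hb with rfl | rfl
    · rfl
    · exact absurd hy (h1 y)
  · exact absurd hx (h1 x)

lemma Prepared.remove_loop {D : Diagram m n} (hP : D.Prepared) {α L a b}
    (hz : .z α L ∈ D.nodes) (hh : .had s(a, b) ∈ D.nodes) (ha : a ∈ L) (hb : b ∈ L) :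
    ∃ D' : Diagram m n, D.Equal D' ∧ D'.Prepared ∧
      (ends D'.nodes).card < (ends D.nodes).card := by
  obtain ⟨N, hN⟩ := Multiset.exists_cons_of_mem hz
  have hh' : Node.had s(a, b) ∈ N := by
    rw [hN] at hh
    simpa using hh
  obtain ⟨C, rfl⟩ := Multiset.exists_cons_of_mem hh'
  have hle : ∀ x, L.count x + ((if x = a then 1 else 0) + if x = b then 1 else 0) ≤ 2 := by
    intro x
    have := D.count_le_two x
    rw [hN] at this
    simp only [ends_cons, legs_z, legs_had, Multiset.insert_eq_cons, Multiset.count_add,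
      Multiset.count_cons, Multiset.count_singleton] at this
    omega
  have hab : a ≠ b := by
    rintro rfl
    have h1 := hle a
    have h2 := Multiset.count_pos.2 ha
    simp only [if_true] at h1
    omega
  obtain ⟨A, rfl⟩ := Multiset.exists_cons_of_mem ha
  obtain ⟨A, rfl⟩ := Multiset.exists_cons_of_mem
    ((Multiset.mem_cons.1 hb).resolve_left hab.symm)
  have hle' : ∀ x, A.count x + (if x = a then 1 else 0) + (if x = b then 1 else 0) +
      ((if x = a then 1 else 0) + if x = b then 1 else 0) ≤ 2 := fun x => by
    have := hle x
    simp only [Multiset.count_cons] at this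
    omega
  refine hP.replace (Derivable.had_loop α A a b hab (fun x => ?_) (fun h => ?_) fun h => ?_)
    (C := C) (by simp only [hN, Multiset.insert_eq_cons, Multiset.cons_add, Multiset.singleton_add])
    ?_ ?_ ?_ ?_ (by simp; omega)
  · have := hle' x
    omega
  · have h1 := hle' a
    have h2 := Multiset.count_pos.2 h
    simp only [if_true] at h1
    omega
  · have h1 := hle' b
    have h2 := Multiset.count_pos.2 h
    simp only [if_true] at h1
    omega
  · simp
  · simp only [Multiset.insert_eq_cons, ends_cons, ends_singleton, legs_z, legs_had, add_zero]
    exact ((Multiset.le_cons_self A b).trans (Multiset.le_cons_self _ a)).trans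
      (Multiset.le_add_right _ _)
  · intro x y hxy
    simp at hxy
    rcases hxy with ⟨rfl, rfl⟩ | ⟨rfl, rfl⟩ <;> simp
  · intro γ h p hm c hc
    simp only [Multiset.insert_eq_cons, Multiset.mem_cons, Multiset.mem_singleton,
      Node.z.injEq, reduceCtorEq, or_false] at hm
    rw [← Multiset.insert_eq_cons] at hm
    refine hab (isolated_had (γ := γ) (h := h) (p := p) (by rw [hm.1, hm.2]; exact hz) hc
      (by rw [hm.2]; simp)
      (by rw [hm.2]; simp) hh (by rw [Sym2.eq_swap]; exact hh))

lemma Prepared.remove_parallel {D : Diagram m n} (hP : D.Prepared) {α β L M a b c d}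
    (hz : .z α L ∈ D.nodes) (hz' : .z β M ∈ D.nodes) (hne : Node.z α L ≠ .z β M)
    (hh : .had s(a, b) ∈ D.nodes) (hh' : .had s(c, d) ∈ D.nodes)
    (ha : a ∈ L) (hb : b ∈ M) (hc : c ∈ L) (hd : d ∈ M) (hs : s(a, b) ≠ s(c, d)) :
    ∃ D' : Diagram m n, D.Equal D' ∧ D'.Prepared ∧
      (ends D'.nodes).card < (ends D.nodes).card := by
  obtain ⟨N, hN⟩ := Multiset.exists_cons_of_mem hz
  have h1 : Node.z β M ∈ N := by
    rw [hN] at hz'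
    exact (Multiset.mem_cons.1 hz').resolve_left hne.symm
  obtain ⟨N, rfl⟩ := Multiset.exists_cons_of_mem h1
  have h2 : Node.had s(a, b) ∈ N := by
    rw [hN] at hh
    simpa using hh
  obtain ⟨N, rfl⟩ := Multiset.exists_cons_of_mem h2
  have h3 : Node.had s(c, d) ∈ N := by
    rw [hN] at hh'
    simp only [Multiset.mem_cons, reduceCtorEq, false_or, Node.had.injEq] at hh'
    exact hh'.resolve_left hs.symm
  obtain ⟨C, rfl⟩ := Multiset.exists_cons_of_mem h3
  have hle : ∀ x, L.count x + M.count x + (if x = a then 1 else 0) + (if x = b then 1 else 0) +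
      (if x = c then 1 else 0) + (if x = d then 1 else 0) ≤ 2 := by
    intro x
    have := D.count_le_two x
    rw [hN] at this
    simp only [ends_cons, legs_z, legs_had, Multiset.insert_eq_cons, Multiset.count_add,
      Multiset.count_cons, Multiset.count_singleton] at this
    omega
  have pa := Multiset.count_pos.2 ha
  have pb := Multiset.count_pos.2 hb
  have pc := Multiset.count_pos.2 hc
  have pd := Multiset.count_pos.2 hd
  have la := hle a
  have lb := hle b
  have lc := hle c
  have ld := hle d
  -- Each of the four names already has one end on a spider and one on a box, so a coincidence would
  -- give a wire too many ends.
  have hab : a ≠ b := by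
    rintro rfl
    simp only [if_true] at la
    omega
  have hac : a ≠ c := by
    rintro rfl
    simp only [if_true] at la
    omega
  have had : a ≠ d := by
    rintro rfl
    simp only [if_true] at la
    omega
  have hbc : b ≠ c := by
    rintro rfl
    simp only [if_true] at lb
    omega
  have hbd : b ≠ d := by
    rintro rfl
    simp only [if_true] at lb
    omega
  have hcd : c ≠ d := by
    rintro rfl
    simp only [if_true] at lc
    omega
  obtain ⟨A, rfl⟩ := Multiset.exists_cons_of_mem ha
  obtain ⟨A, rfl⟩ := Multiset.exists_cons_of_mem
    ((Multiset.mem_cons.1 hc).resolve_left hac.symm)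
  obtain ⟨B, rfl⟩ := Multiset.exists_cons_of_mem hb
  obtain ⟨B, rfl⟩ := Multiset.exists_cons_of_mem
    ((Multiset.mem_cons.1 hd).resolve_left hbd.symm)
  simp only [Multiset.count_cons] at hle
  refine hP.replace (Derivable.had_parallel α β A B a b c d ?_ (fun x => ?_) fun x hx => ?_)
    (C := C) (by simp only [hN, Multiset.insert_eq_cons, Multiset.cons_add, Multiset.singleton_add])
    ?_ ?_ ?_ ?_ (by simp; omega)
  · simp [hab, hac, had, hbc, hbd, hcd]
  · have := hle x
    omega
  · have := hle x
    simp only [List.mem_cons, List.not_mem_nil, or_false] at hx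
    rcases hx with rfl | rfl | rfl | rfl <;> simp only [if_true] at this <;> omega
  · simp
  · simp only [Multiset.insert_eq_cons, ends_cons, ends_singleton, legs_z, legs_had]
    rw [← add_assoc]
    exact (add_le_add ((Multiset.le_cons_self A c).trans (Multiset.le_cons_self _ a))
      ((Multiset.le_cons_self B d).trans (Multiset.le_cons_self _ b))).trans
      (Multiset.le_add_right _ _)
  · intro x y hxy
    simp at hxy
    rcases hxy with (⟨rfl, rfl⟩ | ⟨rfl, rfl⟩) | (⟨rfl, rfl⟩ | ⟨rfl, rfl⟩) <;> simp
  · intro γ h p hm e he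
    simp only [Multiset.insert_eq_cons, Multiset.mem_cons, Multiset.mem_singleton,
      Node.z.injEq, reduceCtorEq, or_false] at hm
    rw [← Multiset.insert_eq_cons] at hm
    rcases hm with hm | hm
    · exact hac (isolated_had (γ := γ) (h := h) (p := p) (by rw [hm.1, hm.2]; exact hz) he
        (by rw [hm.2]; simp)
        (by rw [hm.2]; simp) hh hh')
    · exact hbd (isolated_had (γ := γ) (h := h) (p := p) (by rw [hm.1, hm.2]; exact hz') he
        (by rw [hm.2]; simp)
        (by rw [hm.2]; simp) (by rw [Sym2.eq_swap]; exact hh) (by rw [Sym2.eq_swap]; exact hh'))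

/-! ### Reaching graph-like form -/

lemma Prepared.graphLike {D : Diagram m n} (hP : D.Prepared)
    (hplain : ∀ a, (zSpiderEnds D.nodes).count a ≤ 1)
    (hloop : ∀ α L a b, .z α L ∈ D.nodes → .had s(a, b) ∈ D.nodes → a ∈ L → b ∉ L)
    (hpar : ∀ α β L M a b c d, .z α L ∈ D.nodes → .z β M ∈ D.nodes → Node.z α L ≠ .z β M →
      .had s(a, b) ∈ D.nodes → .had s(c, d) ∈ D.nodes →
      a ∈ L → b ∈ M → c ∈ L → d ∈ M → s(a, b) = s(c, d)) : D.GraphLike where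
  only_z v hv := (hP.reduced v hv).imp_right fun ⟨a, b, h, _⟩ => ⟨_, h⟩
  no_plain := hplain
  had_edge a b h := by
    rcases hP.reduced _ h with ⟨α, L, h⟩ | ⟨x, y, h, hx, hy⟩
    · exact absurd h (by simp)
    · rw [Node.had.injEq, Sym2.eq_iff] at h
      rcases h with ⟨rfl, rfl⟩ | ⟨rfl, rfl⟩
      · exact ⟨hx, hy⟩
      · exact ⟨hy, hx⟩
  no_loop := hloop
  no_parallel α β L M a b c d h1 h2 h3 h4 ha hb hc hd := by
    refine hpar α β L M a b c d h1 h2 (fun h => ?_) h3 h4 ha hb hc hd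
    -- Spiders with the same data need not be told apart: the edge would then count as a loop.
    rw [Node.z.injEq] at h
    exact hloop α L a b h1 h3 ha (h.2 ▸ hb)
  boundary_z p := by
    obtain ⟨γ, h, k, h1, -⟩ := hP.isolated p
    exact mem_zSpiderEnds.2 ⟨γ, _, h1, by simp⟩
  boundary_inj α L p q hz hp hq := by
    obtain ⟨γ, h, k, h1, h2⟩ := hP.isolated p
    obtain ⟨-, -, h3, h4, -⟩ := isolated_legs h1 h2
    -- A second spider on this boundary wire would make it a plain wire between spiders.
    have h5 : Node.z α L = .z γ {h, D.boundary p} := by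
      by_contra hne
      obtain ⟨N, hN⟩ := Multiset.exists_cons_of_mem hz
      rw [hN] at h1
      obtain ⟨N, rfl⟩ := Multiset.exists_cons_of_mem
        ((Multiset.mem_cons.1 h1).resolve_left (Ne.symm hne))
      have h6 := hplain (D.boundary p)
      have h7 := Multiset.count_pos.2 hp
      rw [hN] at h6
      simp only [zSpiderEnds_cons, zLegs_z, Multiset.insert_eq_cons, Multiset.count_add,
        Multiset.count_cons, Multiset.count_singleton, if_true] at h6
      omega
    rw [Node.z.injEq] at h5
    rw [h5.2] at hq
    simp only [Multiset.insert_eq_cons, Multiset.mem_cons, Multiset.mem_singleton] at hq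
    rcases hq with hq | hq
    · have h6 := one_le_count_bdry D.boundary q
      have h7 := D.count_le_two (D.boundary q)
      rw [← hq] at h3
      omega
    · by_contra hne
      have h6 := two_le_count_bdry D.boundary hne hq.symm
      have h7 := D.count_le_two (D.boundary p)
      omega

/-- Descent on the number of wire ends at nodes: each failing condition of `Prepared.graphLike`
supplies a move to a smaller prepared diagram. -/
lemma Prepared.exists_graphLike {D : Diagram m n} (hP : D.Prepared) :
    ∃ D' : Diagram m n, D'.GraphLike ∧ D.Equal D' := by
  induction hk : (ends D.nodes).card using Nat.strong_induction_on generalizing D with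
  | _ k ih =>
  subst hk
  have step : (∃ D' : Diagram m n, D.Equal D' ∧ D'.Prepared ∧
      (ends D'.nodes).card < (ends D.nodes).card) →
      ∃ D' : Diagram m n, D'.GraphLike ∧ D.Equal D' := by
    rintro ⟨D₁, he, hP₁, hlt⟩
    obtain ⟨D₂, hG, he₂⟩ := ih _ hlt hP₁ rfl
    exact ⟨D₂, hG, he.trans he₂⟩
  by_contra hno
  refine hno ⟨D, hP.graphLike (fun a => ?_) (fun α L a b h1 h2 ha hb => ?_)
    (fun α β L M a b c d h1 h2 hne h3 h4 ha hb hc hd => ?_), .refl D⟩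
  · by_contra h
    exact hno (step (hP.fuse (a := a) (by omega)))
  · exact hno (step (hP.remove_loop h1 h2 ha hb))
  · by_contra hs
    exact hno (step (hP.remove_parallel h1 h2 hne h3 h4 ha hb hc hd hs))

end Diagram

end ZX

theorem mainTheorem11 {m n : ℕ} (D : ZX.Diagram m n) :
    ∃ D' : ZX.Diagram m n, D'.GraphLike ∧ D.Equal D' := by
  obtain ⟨D₁, he₁, hr₁⟩ := D.exists_reduced
  obtain ⟨D₂, he₂, hr₂, hI⟩ := D₁.exists_isolated hr₁ Finset.univ
  obtain ⟨D₃, hG, he₃⟩ :=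
    ZX.Diagram.Prepared.exists_graphLike ⟨hr₂, fun p => hI p (Finset.mem_univ p)⟩
  exact ⟨D₃, hG, he₁.trans (he₂.trans he₃)⟩
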